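/- Let $q$ be a power of an odd prime, $n\ge 1$, and let $M=\mathbf M_n(\mathbb F_q)$ be the multiplicative monoid of $n\times n$ matrices over $\mathbb F_q$. Let $U\subset M$ be the group of upper unitriangular matrices, $T$ the group of invertible diagonal matrices, and $\mathcal Q\subset M$ the submonoid of matrices having at most one nonzero entry in each row and in each column. For $k\in[n-1]=\{1,\dots,n-1\}$ let $s_k$ be the permutation matrix of the transposition $(k\ k{+}1)$, and let $\nu=E_{1,2}+\cdots+E_{n-1,n}$, where the $E_{i,j}$ are the matrix units. For $\sigma\in\mathcal Q$ let $\tilde\sigma$ be the matrix obtained by replacing each nonzero entry of $\sigma$ by $1$, and let $I(\sigma)$ and $J(\sigma)$ be the sets of indices of the nonzero rows and columns. Let $\hat\sigma$ be the permutation $i\mapsto i\hat\sigma$ of $\{1,\dots,n\}$ with $\sigma_{i,i\hat\sigma}\neq0$ for $i\in I(\sigma)$ which is increasing on the complement of $I(\sigma)$. For $t=\operatorname{diag}(t_1,\dots,t_n)\in T$ put $t^\sigma=\sum_i t_iE_{i\hat\sigma,i\hat\sigma}$. Let $t_I$ (resp. $t_J$) be the element of $T$ with $\sigma=t_I\tilde\sigma$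 (resp. $\sigma=\tilde\sigma t_J$) whose diagonal entries outside $I(\sigma)$ (resp. $J(\sigma)$) equal $1$. The length of a permutation matrix $w$ is the minimal number of factors in an expression of $w$ as a product of the $s_k$. The length of $\sigma\in\mathcal Q$ of rank $r$ is $$\ell(\sigma)=\min\{\ell(u)+\ell(w)\mid u,w\text{ permutation matrices},\ u\tilde\sigma w=\nu^{\,n-r}\}.$$ In the monoid algebra $\mathbb Q[M]$, for $\sigma\in\mathcal Q$ of rank $r$ put $T_\sigma=q^{r(1-r)/2}\sum_{x\in U\sigma U}x$, and let $H(M,U)=\sum_{\sigma\in\mathcal Q}\mathbb Z\,T_\sigma\subset\mathbb Q[M]$. For $k\in[n-1]$ and $r\in\mathbb F_q^\times$ let $h_k(r)=1+(-r^{-1}-1)E_{k,k}+(r-1)E_{k+1,k+1}$ and $h_k^s(r)=s_kh_k(r)s_k$. **Theorem.** The $T_\sigma$ are linearly independent over $\mathbb Z$, so that $H(M,U)=\bigoplus_{\sigma\in\mathcal Q}\mathbb Z\,T_\sigma$. The module $H(M,U)$ is closed under the multiplication of $\mathbb Q[M]$ and is a unital ring with unit $T_1$, generated as a ring by the $T_{s_k}$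 ($k\in[n-1]$), the $T_t$ ($t\in T$) and $T_\nu$. Moreover: 1. For all $t,t'\in T$ and $\sigma\in\mathcal Q$: $T_t^{\,q-1}=T_1$, $\ T_tT_{t'}=T_{t'}T_t$, and $$T_tT_\sigma=T_{t\sigma}=T_{\sigma t^\sigma}=T_\sigma T_{t^\sigma}.$$ In particular, $(t_I)^\sigma=t_J$ and $T_{t_I}T_\sigma=T_{t_I\sigma}=T_{\sigma t_J}=T_\sigma T_{t_J}$. 2. For all $k\in[n-1]$ and $\sigma\in\mathcal Q$, the differences $\ell(s_k\sigma)-\ell(\sigma)$ and $\ell(\sigma s_k)-\ell(\sigma)$ lie in $\{-1,0,1\}$, and $$T_{s_k}T_\sigma=\begin{cases}qT_\sigma&\text{if }\ell(s_k\sigma)=\ell(\sigma),\\ T_{s_k\sigma}&\text{if }\ell(s_k\sigma)=\ell(\sigma)+1,\\ qT_{s_k\sigma}+\sum_{r\in\mathbb F_q^\times}T_{h_k(r)}T_\sigma&\text{if }\ell(s_k\sigma)=\ell(\sigma)-1,\end{cases}$$ $$T_\sigma T_{s_k}=\begin{cases}qT_\sigma&\text{if }\ell(\sigma s_k)=\ell(\sigma),\\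 T_{\sigma s_k}&\text{if }\ell(\sigma s_k)=\ell(\sigma)+1,\\ qT_{\sigma s_k}+\sum_{r\in\mathbb F_q^\times}T_\sigma T_{h_k^s(r)}&\text{if }\ell(\sigma s_k)=\ell(\sigma)-1.\end{cases}$$ 3. For all $\sigma\in\mathcal Q$: $T_\nu T_\sigma=q^{\ell(\sigma)-\ell(\nu\sigma)}T_{\nu\sigma}$ and $T_\sigma T_\nu=q^{\ell(\sigma)-\ell(\sigma\nu)}T_{\sigma\nu}$. -/

import Mathlib

namespace FramedRook

/-- The generalized rook monoid `Q`: the `n × n` matrices over `F` having at most one nonzero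
entry in each row and in each column. -/
def Q (n : ℕ) (F : Type*) [Field F] : Submonoid (Matrix (Fin n) (Fin n) F) where
  carrier := {σ | (∀ i j j', σ i j ≠ 0 → σ i j' ≠ 0 → j = j') ∧
    (∀ i i' j, σ i j ≠ 0 → σ i' j ≠ 0 → i = i')}
  one_mem' := by
    constructor
    · intro i j j' h h'
      by_contra hne
      by_cases hij : i = j
      · subst hij; exact h' (Matrix.one_apply_ne hne)
      · exact h (Matrix.one_apply_ne hij)
    · intro i i' j h h'
      by_contra hne
      by_cases hij : i = j
      · subst hij; exact h' (Matrix.one_apply_ne (Ne.symm hne))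
      · exact h (Matrix.one_apply_ne hij)
  mul_mem' := by
    rintro a b ⟨ha, ha'⟩ ⟨hb, hb'⟩
    have key : ∀ i j, (a * b) i j ≠ 0 → ∃ k, a i k ≠ 0 ∧ b k j ≠ 0 := by
      intro i j h
      rw [Matrix.mul_apply] at h
      obtain ⟨k, -, hk⟩ := Finset.exists_ne_zero_of_sum_ne_zero h
      exact ⟨k, left_ne_zero_of_mul hk, right_ne_zero_of_mul hk⟩
    constructor
    · intro i j j' h h'
      obtain ⟨k, h1, h2⟩ := key i j h
      obtain ⟨k', h1', h2'⟩ := key i j' h'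
      obtain rfl := ha _ _ _ h1 h1'
      exact hb _ _ _ h2 h2'
    · intro i i' j h h'
      obtain ⟨k, h1, h2⟩ := key i j h
      obtain ⟨k', h1', h2'⟩ := key i' j h'
      obtain rfl := hb' _ _ _ h2 h2'
      exact ha' _ _ _ h1 h1'

section Monoid

variable {n : ℕ} {F : Type*} [Field F]

/-- The entry of `σ ∈ Q` in position `(i, j)`. -/
def entry (σ : Q n F) (i j : Fin n) : F := (σ : Matrix (Fin n) (Fin n) F) i j

/-- The permutation matrix with entry `1` in the positions `(i, p i)`. -/
def perm (p : Equiv.Perm (Fin n)) : Q n F :=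
  ⟨Matrix.of fun i j => if p i = j then 1 else 0, by
    constructor
    · intro i j j' h h'
      simp only [Matrix.of_apply, ne_eq, ite_eq_right_iff, one_ne_zero, imp_false, not_not] at h h'
      exact h.symm.trans h'
    · intro i i' j h h'
      simp only [Matrix.of_apply, ne_eq, ite_eq_right_iff, one_ne_zero, imp_false, not_not] at h h'
      exact p.injective (h.trans h'.symm)⟩

/-- The indices `k` and `k + 1` attached to `k ∈ [n - 1]` (everything is counted from `0`). -/
def lo (k : Fin (n - 1)) : Fin n := ⟨k, by omega⟩

/-- See `lo`. -/
def hi (k : Fin (n - 1)) : Fin n := ⟨k + 1, by omega⟩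

/-- The simple transposition matrix `s_k`. -/
def simple (k : Fin (n - 1)) : Q n F := perm (Equiv.swap (lo k) (hi k))

/-- The torus `T`: the invertible diagonal matrices, given by their diagonal. -/
def diag (t : Fin n → Fˣ) : Q n F :=
  ⟨Matrix.diagonal fun i => (t i : F), by
    constructor
    · intro i j j' h h'
      by_contra hne
      by_cases hij : i = j
      · subst hij; exact h' (Matrix.diagonal_apply_ne _ hne)
      · exact h (Matrix.diagonal_apply_ne _ hij)
    · intro i i' j h h'
      by_contra hne
      by_cases hij : i = j
      · subst hij; exact h' (Matrix.diagonal_apply_ne _ (Ne.symm hne))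
      · exact h (Matrix.diagonal_apply_ne _ hij)⟩

/-- The nilpotent matrix `ν = E_{1,2} + ⋯ + E_{n-1,n}`. -/
def nu : Q n F :=
  ⟨Matrix.of fun i j => if (j : ℕ) = i + 1 then 1 else 0, by
    constructor
    · intro i j j' h h'
      simp only [Matrix.of_apply, ne_eq, ite_eq_right_iff, one_ne_zero, imp_false, not_not] at h h'
      exact Fin.ext (h.trans h'.symm)
    · intro i i' j h h'
      simp only [Matrix.of_apply, ne_eq, ite_eq_right_iff, one_ne_zero, imp_false, not_not] at h h'
      exact Fin.ext (by omega)⟩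

open Classical in
/-- The support matrix `σ̃` of `σ`: every nonzero entry is replaced by `1`. -/
noncomputable def supp (σ : Q n F) : Q n F :=
  ⟨Matrix.of fun i j => if entry σ i j = 0 then 0 else 1, by
    constructor
    · intro i j j' h h'
      simp only [Matrix.of_apply, ne_eq, ite_eq_left_iff, one_ne_zero, imp_false, not_not] at h h'
      exact σ.2.1 i j j' h h'
    · intro i i' j h h'
      simp only [Matrix.of_apply, ne_eq, ite_eq_left_iff, one_ne_zero, imp_false, not_not] at h h'
      exact σ.2.2 i i' j h h'⟩

/-- `I(σ)`: the indices of the nonzero rows. -/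
def rows (σ : Q n F) : Set (Fin n) := {i | ∃ j, entry σ i j ≠ 0}

/-- `J(σ)`: the indices of the nonzero columns. -/
def cols (σ : Q n F) : Set (Fin n) := {j | ∃ i, entry σ i j ≠ 0}

/-- The bijection `i ↦ iσ` from `I(σ)` to `J(σ)`. -/
noncomputable def rowColEquiv (σ : Q n F) : {i // i ∈ rows σ} ≃ {j // j ∈ cols σ} :=
  Equiv.ofBijective (fun i => ⟨i.2.choose, i.1, i.2.choose_spec⟩) (by
    constructor
    · rintro ⟨i, hi⟩ ⟨i', hi'⟩ h
      have h1 : entry σ i' hi.choose ≠ 0 := by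
        have : hi.choose = hi'.choose := congrArg Subtype.val h
        rw [this]; exact hi'.choose_spec
      exact Subtype.ext (σ.2.2 _ _ _ hi.choose_spec h1)
    · rintro ⟨j, i, h⟩
      have hi : i ∈ rows σ := ⟨j, h⟩
      exact ⟨⟨i, hi⟩, Subtype.ext (σ.2.1 _ _ _ hi.choose_spec h)⟩)

open Classical in
theorem card_compl_eq (σ : Q n F) :
    Fintype.card {i // i ∉ rows σ} = Fintype.card {j // j ∉ cols σ} := by
  rw [Fintype.card_subtype_compl, Fintype.card_subtype_compl,
    Fintype.card_congr (rowColEquiv σ)]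

open Classical in
/-- The increasing bijection from the zero rows to the zero columns. -/
noncomputable def complIso (σ : Q n F) : {i // i ∉ rows σ} ≃o {j // j ∉ cols σ} :=
  (Fintype.orderIsoFinOfCardEq _ (card_compl_eq σ)).symm.trans
    (Fintype.orderIsoFinOfCardEq _ rfl)

open Classical in
/-- The permutation `σ̂`: it maps `i` to `iσ` for `i ∈ I(σ)`, and it is increasing on the
complement of `I(σ)`. -/
noncomputable def hat (σ : Q n F) : Equiv.Perm (Fin n) :=
  Equiv.subtypeCongr (rowColEquiv σ) (complIso σ).toEquiv

theorem hat_of_entry_ne_zero (σ : Q n F) {i j : Fin n} (h : entry σ i j ≠ 0) :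
    hat σ i = j := by
  classical
  have hi : i ∈ rows σ := ⟨j, h⟩
  have h1 : hat σ i = rowColEquiv σ ⟨i, hi⟩ := by
    simp [hat, Equiv.subtypeCongr, Equiv.sumCompl_symm_apply_of_pos, hi]
  rw [h1]
  exact σ.2.1 _ _ _ hi.choose_spec h

theorem hat_lt_hat (σ : Q n F) {i j : Fin n} (hi : i ∉ rows σ) (hj : j ∉ rows σ) (hij : i < j) :
    hat σ i < hat σ j := by
  classical
  have h : ∀ {a : Fin n} (ha : a ∉ rows σ), hat σ a = complIso σ ⟨a, ha⟩ := by
    intro a ha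
    simp [hat, Equiv.subtypeCongr, Equiv.sumCompl_symm_apply_of_neg, ha]
  rw [h hi, h hj]
  exact (complIso σ).strictMono (Subtype.mk_lt_mk.2 hij)

/-- For `t ∈ T`, the torus element `t^σ` with `(t^σ)_{i σ̂} = t_i`. -/
noncomputable def twist (t : Fin n → Fˣ) (σ : Q n F) : Fin n → Fˣ :=
  fun j => t ((hat σ).symm j)

open Classical in
/-- The torus element `t_I` of `σ`: its entry in row `i` is the nonzero entry of row `i` of `σ`
if there is one, and `1` otherwise. -/
noncomputable def rowTorus (σ : Q n F) : Fin n → Fˣ :=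
  fun i => if h : ∃ j, entry σ i j ≠ 0 then Units.mk0 _ h.choose_spec else 1

open Classical in
/-- The torus element `t_J` of `σ`: its entry in column `j` is the nonzero entry of column `j`
of `σ` if there is one, and `1` otherwise. -/
noncomputable def colTorus (σ : Q n F) : Fin n → Fˣ :=
  fun j => if h : ∃ i, entry σ i j ≠ 0 then Units.mk0 _ h.choose_spec else 1

theorem rowTorus_mul_supp (σ : Q n F) : diag (rowTorus σ) * supp σ = σ := by
  apply Subtype.ext
  ext i j
  change (Matrix.diagonal _ * _ : Matrix (Fin n) (Fin n) F) i j = entry σ i j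
  rw [Matrix.diagonal_mul]
  by_cases h : entry σ i j = 0
  · simp [supp, h]
  · have hi : ∃ j, entry σ i j ≠ 0 := ⟨j, h⟩
    have hj : hi.choose = j := σ.2.1 _ _ _ hi.choose_spec h
    simp only [rowTorus, dif_pos hi, Units.val_mk0, supp, Matrix.of_apply, if_neg h, mul_one]
    rw [hj]

theorem supp_mul_colTorus (σ : Q n F) : supp σ * diag (colTorus σ) = σ := by
  apply Subtype.ext
  ext i j
  change (_ * Matrix.diagonal _ : Matrix (Fin n) (Fin n) F) i j = entry σ i j
  rw [Matrix.mul_diagonal]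
  by_cases h : entry σ i j = 0
  · simp [supp, h]
  · have hi : ∃ i, entry σ i j ≠ 0 := ⟨i, h⟩
    have hj : hi.choose = i := σ.2.2 _ _ _ hi.choose_spec h
    simp only [colTorus, dif_pos hi, Units.val_mk0, supp, Matrix.of_apply, if_neg h, one_mul]
    rw [hj]

/-- The torus element `h_k(r)`, with entries `-r⁻¹` in position `k`, `r` in position `k + 1`, and
`1` elsewhere. -/
def h (k : Fin (n - 1)) (r : Fˣ) : Q n F :=
  diag fun i => if i = lo k then -r⁻¹ else if i = hi k then r else 1

/-- The torus element `h_k^s(r) = s_k h_k(r) s_k`. -/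
def hs (k : Fin (n - 1)) (r : Fˣ) : Q n F := simple k * h k r * simple k

/-- The rank of `σ`. -/
noncomputable def rk (σ : Q n F) : ℕ := (σ : Matrix (Fin n) (Fin n) F).rank

/-- The length of a permutation matrix: the minimal number of factors in an expression as a
product of simple transpositions `s_k`. -/
noncomputable def weylLength (w : Q n F) : ℕ :=
  sInf {m | ∃ l : List (Fin (n - 1)), l.length = m ∧ (l.map simple).prod = w}

/-- The length of `σ ∈ Q` of rank `r`: the minimum of `ℓ(u) + ℓ(w)` over the permutation matrices
`u`, `w` with `u σ̃ w = ν ^ (n - r)`. -/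
noncomputable def length (σ : Q n F) : ℕ :=
  sInf {m | ∃ u w : Equiv.Perm (Fin n),
    (perm u : Q n F) * supp σ * perm w = nu ^ (n - rk σ) ∧
    weylLength (perm u : Q n F) + weylLength (perm w : Q n F) = m}

end Monoid

section Algebra

variable {n : ℕ} {F : Type*} [Field F]

/-- The upper unitriangular matrices. -/
def U (n : ℕ) (F : Type*) [Field F] : Set (Matrix (Fin n) (Fin n) F) :=
  {u | (∀ i, u i i = 1) ∧ ∀ i j, j < i → u i j = 0}

/-- The double coset `U σ U`. -/
def doubleCoset (σ : Q n F) : Set (Matrix (Fin n) (Fin n) F) :=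
  {x | ∃ u ∈ U n F, ∃ u' ∈ U n F, x = u * σ * u'}

/-- The monoid algebra over `ℚ` of the full matrix monoid `M`. -/
abbrev A (n : ℕ) (F : Type*) [Field F] := MonoidAlgebra ℚ (Matrix (Fin n) (Fin n) F)

/-- `[σ]`, the sum of the elements of `U σ U` in the monoid algebra. -/
noncomputable def cosetSum [Fintype F] (σ : Q n F) : A n F :=
  ∑ x ∈ (Set.toFinite (doubleCoset σ)).toFinset, MonoidAlgebra.of ℚ _ x

/-- `T_σ = q ^ (r (1 - r) / 2) [σ]`, where `r` is the rank of `σ`. -/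
noncomputable def T [Fintype F] (σ : Q n F) : A n F :=
  (Fintype.card F : ℚ) ^ (((rk σ : ℤ) * (1 - (rk σ : ℤ))) / 2) • cosetSum σ

/-- The framed rook algebra `H(M, U)`, as the `ℤ`-module spanned by the `T_σ`. -/
noncomputable def H (n : ℕ) (F : Type*) [Field F] [Fintype F] : Submodule ℤ (A n F) :=
  Submodule.span ℤ (Set.range (T : Q n F → A n F))

end Algebra

end FramedRook

open FramedRook

/-! Let ε = |U|⁻¹ ∑ u over u ∈ U, an idempotent. The element εxε (`av x`) depends only on the double
coset UxU, and the sum over UσU is |UσU| · εσε. The key count is |UσU| = q^(ℓ(σ) + r(r-1)/2), so the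
normalization of T_σ is exactly the one giving T_σ = q^ℓ(σ) εσε (`T_eq_smul_av`). All product
formulas follow by manipulating εxε.

The count needs ℓ in closed form. Give row i the value of the column of its nonzero entry, or n if
the row is zero. Then `len` counts the inversions of these values plus the pairs j < j' with column
j nonzero and column j' zero. Multiplication by s_k changes `len` by at most 1, some s_k lowers it
on one side unless it vanishes, and it vanishes only when σ̃ is a power of ν; hence ℓ = `len`
(`length_eq_len`). The stabilizer {(u, v) : uσ = σv} is an affine space whose dimension is
complementary to ℓ(σ) + r(r-1)/2 (`card_stabFin`).

If xU ⊆ Ux then εxε · εyε = εxyε; this covers T_t and T_ν on the left, and the mirrored inclusion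
covers them on the right. For s = s_k only one root subgroup x(c) of U fails to be conjugated into
U, so q · εsε = ∑_c εs x(c) (`av_simple`). If row k of σ has value at most that of row k+1, then
x(c)σ ∈ σU and all q terms agree. Otherwise c = 0 contributes sσ, and for c = r ≠ 0 the rank one
Bruhat identity s x(r) = x(r⁻¹) h_k(r) x⁻(r⁻¹) contributes h_k(r)σ, since x⁻(r⁻¹)σ ∈ σU. Formulas on
the right come from those on the left by reflection in the antidiagonal.

Distinct σ have disjoint double cosets, which gives independence. Left multiplication by generators
preserves H, and every T_σ is a product of generators by descent on length, so H is a ring. -/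

namespace FramedRook

/-! ### Combinatorial length: inversions, column gaps and antidiagonal reflection -/

section Combinatorics

variable {n : ℕ} {F : Type*} [Field F]

theorem ext_entry {σ τ : Q n F} (h : ∀ i j, entry σ i j = entry τ i j) : σ = τ :=
  Subtype.ext (Matrix.ext h)

theorem entry_mul (σ τ : Q n F) (i j : Fin n) :
    entry (σ * τ) i j = ∑ l, entry σ i l * entry τ l j := rfl

theorem entry_perm (p : Equiv.Perm (Fin n)) (i j : Fin n) :
    entry (perm p : Q n F) i j = if p i = j then 1 else 0 := rfl

theorem entry_nu (i j : Fin n) :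
    entry (nu : Q n F) i j = if (j : ℕ) = i + 1 then 1 else 0 := rfl

theorem entry_one (i j : Fin n) :
    entry (1 : Q n F) i j = if i = j then 1 else 0 := Matrix.one_apply

open Classical in
theorem entry_supp_eq (σ : Q n F) (i j : Fin n) :
    entry (supp σ) i j = if entry σ i j = 0 then 0 else 1 := rfl

theorem entry_supp (σ : Q n F) (i j : Fin n) :
    entry (supp σ) i j ≠ 0 ↔ entry σ i j ≠ 0 := by
  by_cases h : entry σ i j = 0 <;> simp [entry_supp_eq, h]

theorem entry_diag_mul (t : Fin n → Fˣ) (σ : Q n F) (i j : Fin n) :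
    entry (diag t * σ) i j = t i * entry σ i j :=
  Matrix.diagonal_mul _ _ _ _

theorem entry_mul_diag (t : Fin n → Fˣ) (σ : Q n F) (i j : Fin n) :
    entry (σ * diag t) i j = entry σ i j * t j :=
  Matrix.mul_diagonal _ _ _ _

theorem entry_perm_mul (p : Equiv.Perm (Fin n)) (σ : Q n F) (i j : Fin n) :
    entry (perm p * σ) i j = entry σ (p i) j := by
  simp [entry_mul, entry_perm]

theorem entry_mul_perm (p : Equiv.Perm (Fin n)) (σ : Q n F) (i j : Fin n) :
    entry (σ * perm p) i j = entry σ i (p.symm j) := by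
  simp [entry_mul, entry_perm, ← Equiv.eq_symm_apply]

theorem entry_nu_mul (σ : Q n F) (i j : Fin n) :
    entry (nu * σ) i j = if h : (i : ℕ) + 1 < n then entry σ ⟨i + 1, h⟩ j else 0 := by
  rw [entry_mul]
  split_ifs with h
  · rw [Finset.sum_eq_single (⟨i + 1, h⟩ : Fin n)]
    · simp [entry_nu]
    · intro b _ hb
      rw [entry_nu, if_neg, zero_mul]
      exact fun h' => hb (Fin.ext h')
    · simp
  · refine Finset.sum_eq_zero fun b _ => ?_
    rw [entry_nu, if_neg (by omega), zero_mul]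

theorem perm_mul (p p' : Equiv.Perm (Fin n)) : (perm p * perm p' : Q n F) = perm (p.trans p') :=
  ext_entry fun i j => by rw [entry_perm_mul, entry_perm, entry_perm, Equiv.trans_apply]

theorem perm_one : (perm 1 : Q n F) = 1 :=
  ext_entry fun i j => by rw [entry_perm, entry_one]; rfl

theorem simple_mul_simple (k : Fin (n - 1)) : (simple k * simple k : Q n F) = 1 := by
  rw [simple, perm_mul, ← perm_one]
  congr 1
  ext i
  simp

theorem simple_mul_cancel_left (k : Fin (n - 1)) (σ : Q n F) : simple k * (simple k * σ) = σ := by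
  rw [← mul_assoc, simple_mul_simple, one_mul]

theorem simple_mul_cancel_right (k : Fin (n - 1)) (σ : Q n F) : σ * simple k * simple k = σ := by
  rw [mul_assoc, simple_mul_simple, mul_one]

theorem diag_mul_diag (t t' : Fin n → Fˣ) : (diag t * diag t' : Q n F) = diag (t * t') :=
  Subtype.ext ((Matrix.diagonal_mul_diagonal _ _).trans (by simp [diag]))

theorem diag_one : (diag 1 : Q n F) = 1 :=
  Subtype.ext (by simp [diag])

theorem mem_rows_iff_hat (σ : Q n F) (i : Fin n) : i ∈ rows σ ↔ entry σ i (hat σ i) ≠ 0 :=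
  ⟨fun ⟨_, h⟩ => (hat_of_entry_ne_zero σ h).symm ▸ h, fun h => ⟨_, h⟩⟩

theorem mem_cols_iff_hat (σ : Q n F) (j : Fin n) :
    j ∈ cols σ ↔ entry σ ((hat σ).symm j) j ≠ 0 :=
  ⟨fun ⟨i, h⟩ => by rwa [(hat σ).symm_apply_eq.2 (hat_of_entry_ne_zero σ h).symm],
    fun h => ⟨_, h⟩⟩

theorem entry_eq_zero_of_hat_ne (σ : Q n F) {i j : Fin n} (h : hat σ i ≠ j) :
    entry σ i j = 0 := by
  by_contra h'
  exact h (hat_of_entry_ne_zero σ h')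

theorem lo_lt_hi (k : Fin (n - 1)) : lo k < hi k := Fin.mk_lt_mk.2 (Nat.lt_succ_self _)

theorem lo_ne_hi (k : Fin (n - 1)) : lo k ≠ hi k := (lo_lt_hi k).ne

open Classical in
/-- The column of the nonzero entry in row `i` of `σ`, or `n` if row `i` is zero. -/
noncomputable def rowVal (σ : Q n F) (i : Fin n) : ℕ :=
  if i ∈ rows σ then (hat σ i : ℕ) else n

theorem rowVal_of_entry_ne_zero {σ : Q n F} {i j : Fin n} (h : entry σ i j ≠ 0) :
    rowVal σ i = j := by
  rw [rowVal, if_pos ⟨j, h⟩, hat_of_entry_ne_zero σ h]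

theorem rowVal_of_notMem {σ : Q n F} {i : Fin n} (h : i ∉ rows σ) : rowVal σ i = n := if_neg h

theorem rowVal_of_mem {σ : Q n F} {i : Fin n} (h : i ∈ rows σ) : rowVal σ i = hat σ i := if_pos h

theorem rowVal_le (σ : Q n F) (i : Fin n) : rowVal σ i ≤ n := by
  rw [rowVal]; split_ifs <;> omega

theorem rowVal_lt_iff {σ : Q n F} {i : Fin n} : rowVal σ i < n ↔ i ∈ rows σ := by
  rw [rowVal]; split_ifs with h <;> simp [h]

theorem rowVal_eq_iff {σ : Q n F} {i j : Fin n} : rowVal σ i = j ↔ entry σ i j ≠ 0 := by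
  refine ⟨fun h => ?_, rowVal_of_entry_ne_zero⟩
  have hi : i ∈ rows σ := rowVal_lt_iff.1 (h ▸ j.2)
  rw [rowVal_of_mem hi] at h
  rw [← Fin.ext h]
  exact (mem_rows_iff_hat σ i).1 hi

theorem rowVal_congr {σ τ : Q n F} {i i' : Fin n}
    (h : ∀ j, entry σ i j ≠ 0 ↔ entry τ i' j ≠ 0) : rowVal σ i = rowVal τ i' := by
  by_cases hi : i ∈ rows σ
  · obtain ⟨j, hj⟩ := hi
    rw [rowVal_of_entry_ne_zero hj, rowVal_of_entry_ne_zero ((h j).1 hj)]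
  · rw [rowVal_of_notMem hi, rowVal_of_notMem fun ⟨j, hj⟩ => hi ⟨j, (h j).2 hj⟩]

theorem cols_congr {σ τ : Q n F} (p : Equiv.Perm (Fin n))
    (h : ∀ i j, entry σ i j ≠ 0 ↔ entry τ (p i) j ≠ 0) : cols σ = cols τ := by
  ext j
  exact ⟨fun ⟨i, hi⟩ => ⟨_, (h i j).1 hi⟩,
    fun ⟨i, hi⟩ => ⟨p.symm i, (h _ j).2 (by rwa [p.apply_symm_apply])⟩⟩

theorem rowVal_perm_mul (p : Equiv.Perm (Fin n)) (σ : Q n F) (i : Fin n) :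
    rowVal (perm p * σ) i = rowVal σ (p i) :=
  rowVal_congr fun j => by rw [entry_perm_mul]

theorem cols_perm_mul (p : Equiv.Perm (Fin n)) (σ : Q n F) : cols (perm p * σ) = cols σ :=
  cols_congr p fun i j => by rw [entry_perm_mul]

/-- The inversions of `f`. -/
def inversions (f : Fin n → ℕ) : Finset (Fin n × Fin n) :=
  Finset.univ.filter fun p => p.1 < p.2 ∧ f p.2 < f p.1

theorem mem_inversions {f : Fin n → ℕ} {p : Fin n × Fin n} :
    p ∈ inversions f ↔ p.1 < p.2 ∧ f p.2 < f p.1 := by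
  simp [inversions]

theorem swap_lt_swap_iff (k : Fin (n - 1)) (a b : Fin n) (h : ¬(a = lo k ∧ b = hi k))
    (h' : ¬(a = hi k ∧ b = lo k)) :
    Equiv.swap (lo k) (hi k) a < Equiv.swap (lo k) (hi k) b ↔ a < b := by
  have := k.2
  simp only [Equiv.swap_apply_def, lo, hi, Fin.ext_iff, Fin.lt_def] at *
  split_ifs <;> simp only <;> omega

/-- An adjacent transposition preserves the relative order of every pair of positions except the
adjacent pair itself, so the inversions are permuted and exactly one new one appears. -/
theorem card_inversions_swap (f : Fin n → ℕ) (k : Fin (n - 1)) (h : f (lo k) < f (hi k)) :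
    (inversions (f ∘ Equiv.swap (lo k) (hi k))).card = (inversions f).card + 1 := by
  classical
  set s := Equiv.swap (lo k) (hi k) with hs
  have hss : ∀ a, s (s a) = a := Equiv.swap_apply_self _ _
  have key : inversions (f ∘ s) =
      insert (lo k, hi k) ((inversions f).map (Equiv.prodCongr s s).toEmbedding) := by
    ext ⟨a, b⟩
    have hmem : (a, b) ∈ (inversions f).map (Equiv.prodCongr s s).toEmbedding ↔
        s a < s b ∧ f (s b) < f (s a) := by
      rw [Finset.mem_map_equiv, mem_inversions]
      simp [hs]
    rw [Finset.mem_insert, hmem, mem_inversions, Prod.mk.injEq]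
    by_cases h1 : a = lo k ∧ b = hi k
    · obtain ⟨rfl, rfl⟩ := h1
      simp [hs, lo_lt_hi, h]
    · by_cases h2 : a = hi k ∧ b = lo k
      · obtain ⟨rfl, rfl⟩ := h2
        simp [hs, (lo_lt_hi k).not_gt, h.not_gt, (lo_ne_hi k)]
      · simp [swap_lt_swap_iff k a b h1 h2, h1, hs]
  rw [key, Finset.card_insert_of_notMem, Finset.card_map]
  rw [Finset.mem_map_equiv, mem_inversions]
  simp [hs, (lo_lt_hi k).not_gt]

open Classical in
/-- The pairs `j < j'` with column `j` of `σ` nonzero and column `j'` zero. -/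
noncomputable def colGaps (σ : Q n F) : Finset (Fin n × Fin n) :=
  Finset.univ.filter fun p => p.1 < p.2 ∧ p.1 ∈ cols σ ∧ p.2 ∉ cols σ

theorem mem_colGaps {σ : Q n F} {p : Fin n × Fin n} :
    p ∈ colGaps σ ↔ p.1 < p.2 ∧ p.1 ∈ cols σ ∧ p.2 ∉ cols σ := by
  simp [colGaps]

theorem colGaps_congr {σ τ : Q n F} (h : cols σ = cols τ) : colGaps σ = colGaps τ := by
  rw [colGaps, colGaps, h]

/-- The combinatorial description of the length. -/
noncomputable def len (σ : Q n F) : ℕ := (inversions (rowVal σ)).card + (colGaps σ).card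

theorem len_congr {σ τ : Q n F} (h : ∀ i j, entry σ i j ≠ 0 ↔ entry τ i j ≠ 0) :
    len σ = len τ := by
  rw [len, len, colGaps_congr (cols_congr 1 h),
    show rowVal σ = rowVal τ from funext fun i => rowVal_congr (h i)]

theorem len_supp (σ : Q n F) : len (supp σ) = len σ := len_congr (entry_supp σ)

theorem len_diag_mul (t : Fin n → Fˣ) (σ : Q n F) : len (diag t * σ) = len σ :=
  len_congr fun i j => by simp [entry_diag_mul]

theorem len_simple_mul_of_lt {k : Fin (n - 1)} {σ : Q n F}
    (h : rowVal σ (lo k) < rowVal σ (hi k)) : len (simple k * σ) = len σ + 1 := by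
  have h1 : rowVal (simple k * σ) = rowVal σ ∘ Equiv.swap (lo k) (hi k) :=
    funext fun i => rowVal_perm_mul _ σ i
  rw [len, len, h1, card_inversions_swap _ _ h,
    show colGaps (simple k * σ) = colGaps σ from colGaps_congr (cols_perm_mul _ σ)]
  ring

theorem len_simple_mul_of_gt {k : Fin (n - 1)} {σ : Q n F}
    (h : rowVal σ (hi k) < rowVal σ (lo k)) : len (simple k * σ) + 1 = len σ := by
  rw [← len_simple_mul_of_lt, simple_mul_cancel_left]
  rwa [simple, rowVal_perm_mul, rowVal_perm_mul, Equiv.swap_apply_left, Equiv.swap_apply_right]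

theorem notMem_rows_of_rowVal_eq {σ : Q n F} {i i' : Fin n} (hne : i ≠ i')
    (h : rowVal σ i = rowVal σ i') : i ∉ rows σ := by
  rintro ⟨j, hj⟩
  have h1 := rowVal_of_entry_ne_zero hj
  exact hne (σ.2.2 _ _ _ hj (rowVal_eq_iff.1 (h ▸ h1)))

/-- Distinct rows can share a value only when the value is n, so both rows are zero and exchanging
them changes nothing. -/
theorem simple_mul_of_rowVal_eq {k : Fin (n - 1)} {σ : Q n F}
    (h : rowVal σ (lo k) = rowVal σ (hi k)) : simple k * σ = σ := by
  have h1 := notMem_rows_of_rowVal_eq (lo_ne_hi k) h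
  have h2 := notMem_rows_of_rowVal_eq (lo_ne_hi k).symm h.symm
  simp only [rows, Set.mem_ofPred_eq, not_exists, not_not] at h1 h2
  refine ext_entry fun i j => ?_
  rw [simple, entry_perm_mul, Equiv.swap_apply_def]
  split_ifs with h3 h4
  · rw [h3, h1, h2]
  · rw [h4, h1, h2]
  · rfl

theorem len_simple_mul_le (k : Fin (n - 1)) (σ : Q n F) : len (simple k * σ) ≤ len σ + 1 := by
  rcases lt_trichotomy (rowVal σ (lo k)) (rowVal σ (hi k)) with h | h | h
  · exact (len_simple_mul_of_lt h).le
  · rw [simple_mul_of_rowVal_eq h]; omega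
  · have := len_simple_mul_of_gt h; omega

/-- Reflection of a matrix in the antidiagonal. -/
def flipMat {R : Type*} (x : Matrix (Fin n) (Fin n) R) : Matrix (Fin n) (Fin n) R :=
  Matrix.of fun i j => x j.rev i.rev

theorem flipMat_apply {R : Type*} (x : Matrix (Fin n) (Fin n) R) (i j : Fin n) :
    flipMat x i j = x j.rev i.rev := rfl

theorem flipMat_flipMat {R : Type*} (x : Matrix (Fin n) (Fin n) R) : flipMat (flipMat x) = x := by
  ext i j
  simp [flipMat_apply]

theorem flipMat_mul (x y : Matrix (Fin n) (Fin n) F) :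
    flipMat (x * y) = flipMat y * flipMat x := by
  ext i j
  simp only [flipMat_apply, Matrix.mul_apply]
  rw [← Equiv.sum_comp Fin.revPerm]
  exact Finset.sum_congr rfl fun l _ => by simp [mul_comm]

theorem flipMat_one : flipMat (1 : Matrix (Fin n) (Fin n) F) = 1 := by
  ext i j
  simp [flipMat_apply, Matrix.one_apply, eq_comm]

/-- Reflection of an element of `Q` in the antidiagonal. -/
def flip (σ : Q n F) : Q n F :=
  ⟨flipMat σ, fun i _ _ h h' => Fin.rev_injective (σ.2.2 _ _ i.rev h h'),
    fun _ _ j h h' => Fin.rev_injective (σ.2.1 j.rev _ _ h h')⟩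

theorem entry_flip (σ : Q n F) (i j : Fin n) : entry (flip σ) i j = entry σ j.rev i.rev := rfl

theorem flip_flip (σ : Q n F) : flip (flip σ) = σ := Subtype.ext (flipMat_flipMat _)

theorem flip_mul (σ τ : Q n F) : flip (σ * τ) = flip τ * flip σ := Subtype.ext (flipMat_mul _ _)

theorem flip_simple (k : Fin (n - 1)) : flip (simple k : Q n F) = simple k.rev := by
  refine ext_entry fun i j => ?_
  rw [entry_flip, simple, simple, entry_perm, entry_perm]
  have h1 : lo k.rev = (hi k).rev := by
    simp only [lo, hi, Fin.ext_iff, Fin.val_rev]; omega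
  have h2 : hi k.rev = (lo k).rev := by
    simp only [lo, hi, Fin.ext_iff, Fin.val_rev]; omega
  congr 1
  rw [h1, h2, Equiv.swap_comm (hi k).rev, eq_iff_iff, ← Equiv.eq_symm_apply, Equiv.symm_swap]
  have h3 := Function.Injective.swap_apply Fin.rev_injective (lo k) (hi k) i.rev
  rw [Fin.rev_rev] at h3
  rw [h3]
  constructor <;> intro h
  · rw [← h, Fin.rev_rev]
  · rw [← h, Fin.rev_rev]

theorem flip_nu : flip (nu : Q n F) = nu := by
  refine ext_entry fun i j => ?_
  rw [entry_flip, entry_nu, entry_nu]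
  congr 1
  simp only [Fin.val_rev, eq_iff_iff]
  omega

theorem mem_cols_flip {σ : Q n F} {j : Fin n} : j ∈ cols (flip σ) ↔ j.rev ∈ rows σ :=
  ⟨fun ⟨i, hi⟩ => ⟨i.rev, hi⟩, fun ⟨i, hi⟩ => ⟨i.rev, by rwa [entry_flip, Fin.rev_rev]⟩⟩

theorem mem_rows_flip {σ : Q n F} {j : Fin n} : j ∈ rows (flip σ) ↔ j.rev ∈ cols σ := by
  rw [← Fin.rev_rev j, ← mem_cols_flip, flip_flip, Fin.rev_rev]

/-- An inversion whose first row is zero is a zero row above a nonzero one, and reflection turns it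
into a column gap. Thus `len` becomes a sum of the two kinds of gaps and of the inversions among
nonzero entries, a form symmetric under `flip`. -/
theorem card_inversions_rowVal_split (σ : Q n F) : (inversions (rowVal σ)).card =
    (colGaps (flip σ)).card +
      ((inversions (rowVal σ)).filter fun p => rowVal σ p.1 < n).card := by
  rw [← Finset.card_filter_add_card_filter_not (s := inversions (rowVal σ))
    (p := fun p => rowVal σ p.1 < n), add_comm]
  congr 1
  refine Finset.card_bij' (fun p _ => (p.2.rev, p.1.rev)) (fun p _ => (p.2.rev, p.1.rev))
    ?_ ?_ (fun _ _ => by simp) (fun _ _ => by simp)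
  · rintro ⟨a, b⟩ h
    rw [Finset.mem_filter, mem_inversions, rowVal_lt_iff] at h
    rw [mem_colGaps, mem_cols_flip, mem_cols_flip, Fin.rev_rev, Fin.rev_rev]
    exact ⟨Fin.rev_lt_rev.2 h.1.1, rowVal_lt_iff.1 (h.1.2.trans_le (rowVal_le _ _)), h.2⟩
  · rintro ⟨a, b⟩ h
    rw [mem_colGaps, mem_cols_flip, mem_cols_flip] at h
    rw [Finset.mem_filter, mem_inversions, rowVal_lt_iff]
    refine ⟨⟨Fin.rev_lt_rev.2 h.1, ?_⟩, h.2.2⟩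
    rw [rowVal_of_notMem h.2.2]
    exact rowVal_lt_iff.2 h.2.1

theorem card_inversions_inner_le_flip (σ : Q n F) :
    ((inversions (rowVal σ)).filter fun p => rowVal σ p.1 < n).card ≤
    ((inversions (rowVal (flip σ))).filter fun p => rowVal (flip σ) p.1 < n).card := by
  -- An inverted pair of nonzero entries remains inverted after reflection; its new row indices are
  -- the reversed old columns.
  refine Finset.card_le_card_of_injOn (fun p => ((hat σ p.1).rev, (hat σ p.2).rev)) ?_ ?_
  · rintro ⟨a, b⟩ h
    rw [Finset.mem_coe, Finset.mem_filter, mem_inversions, rowVal_lt_iff] at h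
    obtain ⟨⟨hab, hv⟩, ha⟩ := h
    have hb : b ∈ rows σ := rowVal_lt_iff.1 (hv.trans_le (rowVal_le _ _))
    rw [rowVal_of_mem ha, rowVal_of_mem hb] at hv
    have key : ∀ {c}, c ∈ rows σ → rowVal (flip σ) (hat σ c).rev = (c.rev : Fin n) := by
      intro c hc
      apply rowVal_of_entry_ne_zero
      rw [entry_flip, Fin.rev_rev, Fin.rev_rev]
      exact (mem_rows_iff_hat σ c).1 hc
    rw [Finset.mem_coe, Finset.mem_filter, mem_inversions]
    simp only
    rw [key ha, key hb]
    exact ⟨⟨Fin.rev_lt_rev.2 hv, Fin.rev_lt_rev.2 hab⟩, Fin.is_lt _⟩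
  · rintro ⟨a, b⟩ _ ⟨a', b'⟩ _ h
    simpa using h

theorem len_le_len_flip (σ : Q n F) : len σ ≤ len (flip σ) := by
  have h1 := card_inversions_rowVal_split σ
  have h2 := card_inversions_rowVal_split (flip σ)
  have h3 := card_inversions_inner_le_flip σ
  rw [flip_flip] at h2
  rw [len, len]
  omega

theorem len_flip (σ : Q n F) : len (flip σ) = len σ :=
  le_antisymm ((len_le_len_flip _).trans_eq (by rw [flip_flip])) (len_le_len_flip σ)

theorem len_mul_diag (t : Fin n → Fˣ) (σ : Q n F) : len (σ * diag t) = len σ :=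
  len_congr fun i j => by simp [entry_mul_diag]

/-- Without an adjacent descent the row values would be weakly increasing, leaving no inversion. -/
theorem exists_descent_of_inversions {σ : Q n F} (h : inversions (rowVal σ) ≠ ∅) :
    ∃ k, len (simple k * σ) + 1 = len σ := by
  by_contra! hk
  have hle : ∀ k : Fin (n - 1), rowVal σ (lo k) ≤ rowVal σ (hi k) := fun k =>
    not_lt.1 fun hlt => hk k (len_simple_mul_of_gt hlt)
  have hmono : ∀ d (a b : Fin n), (b : ℕ) = a + d → rowVal σ a ≤ rowVal σ b := by
    intro d
    induction d with
    | zero => intro a b hab; rw [Fin.ext (hab.trans (add_zero _))]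
    | succ d ih =>
      intro a b hab
      have hb := b.2
      refine (ih a ⟨a + d, by omega⟩ rfl).trans ?_
      have := hle ⟨a + d, by omega⟩
      rwa [show hi (⟨a + d, by omega⟩ : Fin (n - 1)) = b from Fin.ext (by simp [hi]; omega)] at this
  obtain ⟨p, hp⟩ := Finset.nonempty_iff_ne_empty.2 h
  rw [mem_inversions] at hp
  exact (hmono (p.2 - p.1) p.1 p.2 (by have := Fin.lt_def.1 hp.1; omega)).not_gt hp.2

/-- If the row values have no inversion, the length comes from column gaps alone. These are
inversions of the reflected element, whose left descent is a right descent of σ. -/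
theorem exists_descent {σ : Q n F} (h : len σ ≠ 0) :
    (∃ k, len (simple k * σ) + 1 = len σ) ∨ ∃ k, len (σ * simple k) + 1 = len σ := by
  by_cases h1 : inversions (rowVal σ) = ∅
  · right
    have h2 : inversions (rowVal (flip σ)) ≠ ∅ := by
      intro h2
      have h3 := card_inversions_rowVal_split (flip σ)
      rw [flip_flip, h2] at h3
      rw [len, h1] at h
      simp only [Finset.card_empty] at h h3
      omega
    obtain ⟨k, hk⟩ := exists_descent_of_inversions h2
    refine ⟨k.rev, ?_⟩
    rw [← len_flip, flip_mul, flip_simple, Fin.rev_rev, hk, len_flip]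
  · exact Or.inl (exists_descent_of_inversions h1)

theorem len_mul_simple_le (k : Fin (n - 1)) (σ : Q n F) : len (σ * simple k) ≤ len σ + 1 := by
  rw [← len_flip, flip_mul, flip_simple, ← len_flip σ]
  exact len_simple_mul_le _ _

theorem len_one : len (1 : Q n F) = 0 := by
  have h1 : ∀ i, rowVal (1 : Q n F) i = i := fun i =>
    rowVal_of_entry_ne_zero (by simp [entry_one])
  rw [len, Nat.add_eq_zero_iff, Finset.card_eq_zero, Finset.card_eq_zero]
  constructor <;> refine Finset.eq_empty_of_forall_notMem fun p hp => ?_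
  · rw [mem_inversions, h1, h1] at hp
    exact hp.1.not_gt hp.2
  · rw [mem_colGaps] at hp
    exact hp.2.2 ⟨p.2, by simp [entry_one]⟩

end Combinatorics

/-! ### Multiplication by ν, elements of length zero, and equality of the two lengths -/

section Length

variable {n : ℕ} {F : Type*} [Field F]

theorem rowVal_nu_mul_lt {σ : Q n F} {i : Fin n} (h : rowVal (nu * σ) i < n) :
    ∃ h : (i : ℕ) + 1 < n, rowVal (nu * σ) i = rowVal σ ⟨i + 1, h⟩ := by
  obtain ⟨j, hj⟩ := rowVal_lt_iff.1 h
  rw [entry_nu_mul] at hj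
  split_ifs at hj with h1
  · exact ⟨h1, rowVal_congr fun j => by rw [entry_nu_mul, dif_pos h1]⟩
  · exact absurd rfl hj

theorem cols_nu_mul_subset (σ : Q n F) {j : Fin n} (h : j ∈ cols (nu * σ)) :
    ∃ i : Fin n, (i : ℕ) ≠ 0 ∧ entry σ i j ≠ 0 := by
  obtain ⟨i, hi⟩ := h
  rw [entry_nu_mul] at hi
  split_ifs at hi with h1
  · exact ⟨_, Nat.succ_ne_zero _, hi⟩
  · exact absurd rfl hi

theorem mem_cols_nu_mul (σ : Q n F) {i j : Fin n} (h : (i : ℕ) ≠ 0) (h' : entry σ i j ≠ 0) :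
    j ∈ cols (nu * σ) := by
  refine ⟨⟨i - 1, by omega⟩, ?_⟩
  have h2 : (i : ℕ) - 1 + 1 = i := by omega
  have h1 : (i : ℕ) - 1 + 1 < n := h2 ▸ i.2
  rw [entry_nu_mul, dif_pos h1]
  have : (⟨(i : ℕ) - 1 + 1, h1⟩ : Fin n) = i := Fin.ext h2
  rwa [this]

/-- Left multiplication by ν shifts the rows up by one, discarding row 0 and adding a zero last row.
The new last row has the maximal value n and is in no inversion, so every inversion comes from one
of σ that avoids row 0. -/
theorem card_inversions_nu_mul_le (σ : Q n F) :
    (inversions (rowVal (nu * σ))).card ≤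
      ((inversions (rowVal σ)).filter fun p => ¬(p.1 : ℕ) = 0).card := by
  refine Finset.card_le_card_of_injOn
    -- The fallback value `p` is never taken on an inversion: the second row has value below n,
    -- hence is not the last row.
    (fun p => if h : (p.1 : ℕ) + 1 < n ∧ (p.2 : ℕ) + 1 < n then
      (⟨p.1 + 1, h.1⟩, ⟨p.2 + 1, h.2⟩) else p) ?_ ?_
  · rintro ⟨a, b⟩ h
    rw [Finset.mem_coe, mem_inversions] at h
    obtain ⟨hb, hb'⟩ := rowVal_nu_mul_lt (h.2.trans_le (rowVal_le _ _))
    have hab := Fin.lt_def.1 h.1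
    simp only at hab hb
    have ha : (a : ℕ) + 1 < n := by omega
    have ha' : rowVal (nu * σ) a = rowVal σ ⟨a + 1, ha⟩ :=
      rowVal_congr fun j => by rw [entry_nu_mul, dif_pos ha]
    rw [Finset.mem_coe, Finset.mem_filter, mem_inversions]
    simp only [ha, hb, and_self, dite_true]
    refine ⟨⟨Fin.mk_lt_mk.2 (by omega), ?_⟩, Nat.succ_ne_zero _⟩
    rw [← ha', ← hb']
    exact h.2
  · rintro ⟨a, b⟩ h ⟨a', b'⟩ h' heq
    rw [Finset.mem_coe, mem_inversions] at h h'
    obtain ⟨hb, -⟩ := rowVal_nu_mul_lt (h.2.trans_le (rowVal_le _ _))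
    obtain ⟨hb', -⟩ := rowVal_nu_mul_lt (h'.2.trans_le (rowVal_le _ _))
    have hab := Fin.lt_def.1 h.1
    have hab' := Fin.lt_def.1 h'.1
    simp only at hab hab' hb hb'
    have ha : (a : ℕ) + 1 < n := by omega
    have ha' : (a' : ℕ) + 1 < n := by omega
    simp only [ha, hb, ha', hb', and_self, dite_true, Prod.mk.injEq, Fin.mk.injEq] at heq
    rw [Prod.mk.injEq, Fin.ext_iff, Fin.ext_iff]
    omega

/-- A gap (j, j') that is new in νσ arises because column j' lost its entry with row 0. It is
charged to the inversion of σ between row 0 and the row of the entry in column j; these are the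
inversions not used in `card_inversions_nu_mul_le`. -/
theorem card_colGaps_nu_mul_le (σ : Q n F) :
    (colGaps (nu * σ)).card ≤ (colGaps σ).card +
      ((inversions (rowVal σ)).filter fun p => (p.1 : ℕ) = 0).card := by
  classical
  rw [← Finset.card_filter_add_card_filter_not (s := colGaps (nu * σ))
    (p := fun p => p.2 ∉ cols σ)]
  refine add_le_add (Finset.card_le_card fun p hp => ?_)
    (Finset.card_le_card_of_injOn
      (fun p => (⟨0, p.1.pos⟩, (hat σ).symm p.1)) ?_ ?_)
  · rw [Finset.mem_filter, mem_colGaps] at hp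
    obtain ⟨i, -, hi⟩ := cols_nu_mul_subset σ hp.1.2.1
    exact mem_colGaps.2 ⟨hp.1.1, ⟨i, hi⟩, hp.2⟩
  · rintro ⟨a, b⟩ h
    rw [Finset.mem_coe, Finset.mem_filter, mem_colGaps, not_not] at h
    obtain ⟨⟨hab, ha, hb⟩, i, hi⟩ := h
    obtain ⟨i', hi0, hi'⟩ := cols_nu_mul_subset σ ha
    -- Only row 0 is discarded, so a column that becomes zero had its entry there.
    have h0 : i = ⟨0, a.pos⟩ := by
      by_contra hne
      exact hb (mem_cols_nu_mul σ (fun h => hne (Fin.ext h)) hi)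
    have h1 : (hat σ).symm a = i' := (Equiv.symm_apply_eq _).2 (hat_of_entry_ne_zero σ hi').symm
    rw [Finset.mem_coe, Finset.mem_filter, mem_inversions]
    simp only
    rw [h1, rowVal_of_entry_ne_zero hi', ← h0, rowVal_of_entry_ne_zero hi]
    refine ⟨⟨?_, hab⟩, trivial⟩
    rw [h0, Fin.lt_def]
    exact Nat.pos_of_ne_zero hi0
  · rintro ⟨a, b⟩ h ⟨a', b'⟩ h' heq
    rw [Finset.mem_coe, Finset.mem_filter, mem_colGaps, not_not] at h h'
    obtain ⟨⟨hab, ha, hb⟩, i, hi⟩ := h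
    obtain ⟨⟨hab', ha', hb'⟩, i', hi'⟩ := h'
    have h0 : i = ⟨0, a.pos⟩ := by
      by_contra hne
      exact hb (mem_cols_nu_mul σ (fun h => hne (Fin.ext h)) hi)
    have h0' : i' = ⟨0, a.pos⟩ := by
      by_contra hne
      exact hb' (mem_cols_nu_mul σ (fun h => hne (Fin.ext h)) hi')
    subst h0 h0'
    simp only [Prod.mk.injEq, EmbeddingLike.apply_eq_iff_eq, true_and] at heq
    exact Prod.ext heq (σ.2.1 _ _ _ hi hi')

theorem len_nu_mul_le (σ : Q n F) : len (nu * σ) ≤ len σ := by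
  have h1 := card_inversions_nu_mul_le σ
  have h2 := card_colGaps_nu_mul_le σ
  have h3 := Finset.card_filter_add_card_filter_not (s := inversions (rowVal σ))
    (p := fun p => (p.1 : ℕ) = 0)
  rw [len, len]
  omega

theorem len_nu_pow (m : ℕ) : len (nu ^ m : Q n F) = 0 := by
  induction m with
  | zero => exact len_one
  | succ m ih =>
    rw [pow_succ']
    exact Nat.eq_zero_of_le_zero (ih ▸ len_nu_mul_le _)

theorem entry_nu_pow (m : ℕ) (i j : Fin n) :
    entry (nu ^ m : Q n F) i j = if (j : ℕ) = i + m then 1 else 0 := by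
  induction m generalizing i with
  | zero => rw [pow_zero, entry_one]; simp [Fin.ext_iff, eq_comm]
  | succ m ih =>
    rw [pow_succ', entry_nu_mul]
    split_ifs with h1 h2 h2
    · rw [ih, if_pos (by simp only; omega)]
    · rw [ih, if_neg (by simp only; omega)]
    · omega
    · rfl

open Classical in
theorem rk_eq_card_rows (σ : Q n F) : rk σ = (Finset.univ.filter (· ∈ rows σ)).card := by
  -- σ is a diagonal matrix times the invertible permutation matrix of `hat σ`, so its rank is the
  -- number of nonzero diagonal entries.
  have h1 : (σ : Matrix (Fin n) (Fin n) F) =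
      Matrix.diagonal (fun i => entry σ i (hat σ i)) *
        ((perm (hat σ) : Q n F) : Matrix (Fin n) (Fin n) F) := by
    ext i j
    rw [Matrix.diagonal_mul]
    change entry σ i j = _ * entry (perm (hat σ)) i j
    rw [entry_perm]
    split_ifs with h
    · rw [h, mul_one]
    · rw [entry_eq_zero_of_hat_ne σ h, mul_zero]
  have h2 : IsUnit ((perm (hat σ) : Q n F) : Matrix (Fin n) (Fin n) F).det := by
    rw [← Matrix.isUnit_iff_isUnit_det]
    refine IsUnit.of_mul_eq_one ((perm (hat σ).symm : Q n F) : Matrix (Fin n) (Fin n) F) ?_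
    have : (perm (hat σ) * perm (hat σ).symm : Q n F) = 1 := by
      rw [perm_mul, Equiv.self_trans_symm]; exact perm_one
    exact congrArg Subtype.val this
  rw [rk, h1, Matrix.rank_mul_eq_left_of_isUnit_det _ _ h2, Matrix.rank_diagonal,
    Fintype.card_subtype]
  simp only [mem_rows_iff_hat]

open Classical in
theorem rk_eq_card_cols (σ : Q n F) : rk σ = (Finset.univ.filter (· ∈ cols σ)).card := by
  rw [rk_eq_card_rows, ← Fintype.card_subtype, ← Fintype.card_subtype]
  exact Fintype.card_congr (rowColEquiv σ)

theorem rk_perm_mul (p : Equiv.Perm (Fin n)) (σ : Q n F) : rk (perm p * σ) = rk σ := by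
  rw [rk_eq_card_cols, rk_eq_card_cols, cols_perm_mul]

theorem rk_flip (σ : Q n F) : rk (flip σ) = rk σ := by
  classical
  rw [rk_eq_card_rows, rk_eq_card_cols, ← Fintype.card_subtype, ← Fintype.card_subtype]
  exact Fintype.card_congr (Fin.revPerm.subtypeEquiv fun i => mem_rows_flip)

theorem rk_mul_simple (k : Fin (n - 1)) (σ : Q n F) : rk (σ * simple k) = rk σ := by
  rw [← rk_flip, flip_mul, flip_simple, simple, rk_perm_mul, rk_flip]

theorem rk_le (σ : Q n F) : rk σ ≤ n := by
  classical
  rw [rk_eq_card_rows]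
  exact (Finset.card_le_univ _).trans_eq (Fintype.card_fin n)

/-- With no inversions the nonzero rows come first and their columns increase; with no gaps the
nonzero columns come last. Only the shifted diagonal of ν^(n-r) fits. -/
theorem entry_ne_zero_iff_of_len_eq_zero {σ : Q n F} (h : len σ = 0) (i j : Fin n) :
    entry σ i j ≠ 0 ↔ (j : ℕ) = i + (n - rk σ) := by
  classical
  rw [len, Nat.add_eq_zero_iff, Finset.card_eq_zero, Finset.card_eq_zero] at h
  have hmono : ∀ a b : Fin n, a ≤ b → rowVal σ a ≤ rowVal σ b := by
    intro a b hab
    rcases hab.eq_or_lt with rfl | hab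
    · exact le_rfl
    · by_contra hlt
      have : (a, b) ∈ inversions (rowVal σ) := mem_inversions.2 ⟨hab, not_le.1 hlt⟩
      rw [h.1] at this
      exact absurd this (Finset.notMem_empty _)
  have hcol : ∀ a b : Fin n, a ≤ b → a ∈ cols σ → b ∈ cols σ := by
    intro a b hab ha
    rcases hab.eq_or_lt with rfl | hab
    · exact ha
    · by_contra hb
      have : (a, b) ∈ colGaps σ := mem_colGaps.2 ⟨hab, ha, hb⟩
      rw [h.2] at this
      exact absurd this (Finset.notMem_empty _)
  -- The r nonzero rows are the i rows before i together with those from i on, and the latter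
  -- correspond to the n - j columns from j on.
  have key : ∀ i j : Fin n, entry σ i j ≠ 0 → rk σ + j = i + n := by
    intro i j hij
    have hv := rowVal_of_entry_ne_zero hij
    have h1 : (Finset.univ.filter (· ∈ rows σ)).filter (· < i) = Finset.Iio i := by
      ext a
      simp only [Finset.mem_filter, Finset.mem_univ, true_and, Finset.mem_Iio,
        and_iff_right_iff_imp]
      intro ha
      exact rowVal_lt_iff.1 ((hmono a i ha.le).trans_lt (hv ▸ j.2))
    have h2 : ((Finset.univ.filter (· ∈ rows σ)).filter (¬ · < i)).card =
        (Finset.Ici j).card := by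
      refine Finset.card_bij (fun a _ => hat σ a) ?_ (fun a _ b _ hab => (hat σ).injective hab) ?_
      · intro a ha
        simp only [Finset.mem_filter, Finset.mem_univ, true_and, not_lt] at ha
        have h3 := hmono i a ha.2
        rw [hv, rowVal_of_mem ha.1] at h3
        exact Finset.mem_Ici.2 h3
      · intro b hb
        obtain ⟨a, ha⟩ := hcol j b (Finset.mem_Ici.1 hb) ⟨i, hij⟩
        refine ⟨a, ?_, hat_of_entry_ne_zero σ ha⟩
        simp only [Finset.mem_filter, Finset.mem_univ, true_and, not_lt]
        refine ⟨⟨b, ha⟩, not_lt.1 fun hlt => ?_⟩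
        have h3 := hmono a i hlt.le
        rw [hv, rowVal_of_entry_ne_zero ha] at h3
        have h4 : b = j := le_antisymm h3 (Finset.mem_Ici.1 hb)
        subst h4
        exact hlt.ne (σ.2.2 _ _ _ ha hij)
    have h3 := Finset.card_filter_add_card_filter_not (s := Finset.univ.filter (· ∈ rows σ))
      (p := (· < i))
    rw [h1, h2, ← rk_eq_card_rows, Fin.card_Iio, Fin.card_Ici] at h3
    have := j.2
    omega
  have hr := rk_le σ
  refine ⟨fun hij => by have := key i j hij; omega, fun hij => ?_⟩
  -- If row i were zero, all nonzero rows would precede it, so r ≤ i, contradicting i + (n - r) = j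
  -- < n.
  have hi : i ∈ rows σ := by
    by_contra hi
    have h1 : Finset.univ.filter (· ∈ rows σ) ⊆ Finset.Iio i := by
      intro a ha
      rw [Finset.mem_filter] at ha
      rw [Finset.mem_Iio]
      refine not_le.1 fun hle => hi (rowVal_lt_iff.1 ((hmono i a hle).trans_lt ?_))
      exact rowVal_lt_iff.2 ha.2
    have h2 := Finset.card_le_card h1
    rw [← rk_eq_card_rows, Fin.card_Iio] at h2
    have := j.2
    omega
  obtain ⟨j', hj'⟩ := hi
  have h1 := key i j' hj'
  rwa [show j = j' from Fin.ext (by omega)]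

theorem supp_eq_of_len_eq_zero {σ : Q n F} (h : len σ = 0) : supp σ = nu ^ (n - rk σ) := by
  classical
  refine ext_entry fun i j => ?_
  rw [entry_nu_pow]
  have h1 := entry_ne_zero_iff_of_len_eq_zero h i j
  by_cases h2 : entry σ i j = 0
  · rw [if_neg (fun h3 => h1.2 h3 h2)]
    rw [entry_supp_eq, if_pos h2]
  · rw [if_pos (h1.1 h2)]
    rw [entry_supp_eq, if_neg h2]

theorem supp_simple_mul (k : Fin (n - 1)) (σ : Q n F) : supp (simple k * σ) = simple k * supp σ :=
  ext_entry fun i j => by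
    rw [simple, entry_perm_mul, entry_supp_eq, entry_perm_mul, entry_supp_eq]

theorem supp_mul_simple (k : Fin (n - 1)) (σ : Q n F) : supp (σ * simple k) = supp σ * simple k :=
  ext_entry fun i j => by
    rw [simple, entry_mul_perm, entry_supp_eq, entry_mul_perm, entry_supp_eq]

theorem exists_list_simple (p : Equiv.Perm (Fin n)) :
    ∃ l : List (Fin (n - 1)), (l.map simple).prod = (perm p : Q n F) := by
  cases n with
  | zero => exact ⟨[], by rw [Subsingleton.elim p 1, perm_one]; rfl⟩
  | succ n =>
    have hp : p ∈ Submonoid.closure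
        (Set.range fun i : Fin n => Equiv.swap i.castSucc i.succ) := by
      rw [Equiv.Perm.mclosure_swap_castSucc_succ]; trivial
    induction hp using Submonoid.closure_induction with
    | mem x hx =>
      obtain ⟨i, rfl⟩ := hx
      exact ⟨[i], by rw [List.map_singleton, List.prod_singleton]; rfl⟩
    | one => exact ⟨[], by rw [perm_one]; rfl⟩
    | mul x y _ _ ihx ihy =>
      obtain ⟨l, hl⟩ := ihx
      obtain ⟨l', hl'⟩ := ihy
      -- The words are concatenated in reverse, since `perm` turns composition of permutations into
      -- the opposite product of matrices.
      refine ⟨l' ++ l, ?_⟩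
      rw [List.map_append, List.prod_append, hl, hl', perm_mul]
      rfl

theorem exists_list_weylLength (p : Equiv.Perm (Fin n)) :
    ∃ l : List (Fin (n - 1)), l.length = weylLength (perm p : Q n F) ∧
      (l.map simple).prod = (perm p : Q n F) := by
  obtain ⟨l, hl⟩ := exists_list_simple (F := F) p
  exact Nat.sInf_mem (s := {m | ∃ l : List (Fin (n - 1)), l.length = m ∧
    (l.map simple).prod = (perm p : Q n F)}) ⟨_, l, rfl, hl⟩

theorem weylLength_list_le (l : List (Fin (n - 1))) :
    weylLength ((l.map simple).prod : Q n F) ≤ l.length :=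
  Nat.sInf_le ⟨l, rfl, rfl⟩

theorem weylLength_simple_mul_le (k : Fin (n - 1)) (p : Equiv.Perm (Fin n)) :
    weylLength (simple k * perm p : Q n F) ≤ weylLength (perm p : Q n F) + 1 := by
  obtain ⟨l, hl, hp⟩ := exists_list_weylLength (F := F) p
  rw [← hl, ← hp]
  simpa using weylLength_list_le (F := F) (k :: l)

theorem weylLength_mul_simple_le (k : Fin (n - 1)) (p : Equiv.Perm (Fin n)) :
    weylLength (perm p * simple k : Q n F) ≤ weylLength (perm p : Q n F) + 1 := by
  obtain ⟨l, hl, hp⟩ := exists_list_weylLength (F := F) p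
  rw [← hl, ← hp]
  simpa using weylLength_list_le (F := F) (l ++ [k])

theorem len_le_list_mul (l : List (Fin (n - 1))) (σ : Q n F) :
    len σ ≤ len ((l.map simple).prod * σ) + l.length := by
  induction l with
  | nil => simp
  | cons k l ih =>
    rw [List.map_cons, List.prod_cons, mul_assoc, List.length_cons]
    have := len_simple_mul_le k (simple k * ((l.map simple).prod * σ))
    rw [simple_mul_cancel_left] at this
    omega

theorem len_le_mul_list (l : List (Fin (n - 1))) (σ : Q n F) :
    len σ ≤ len (σ * (l.map simple).prod) + l.length := by
  induction l generalizing σ with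
  | nil => simp
  | cons k l ih =>
    rw [List.map_cons, List.prod_cons, ← mul_assoc, List.length_cons]
    have := len_mul_simple_le k (σ * simple k)
    rw [simple_mul_cancel_right] at this
    have := ih (σ * simple k)
    omega

theorem exists_perm_weylLength_le (m : ℕ) (σ : Q n F) (h : len σ = m) :
    ∃ u w : Equiv.Perm (Fin n), (perm u : Q n F) * supp σ * perm w = nu ^ (n - rk σ) ∧
      weylLength (perm u : Q n F) + weylLength (perm w : Q n F) ≤ m := by
  induction m generalizing σ with
  | zero =>
    refine ⟨1, 1, ?_, ?_⟩
    · rw [perm_one, one_mul, mul_one, supp_eq_of_len_eq_zero h]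
    · have := weylLength_list_le (n := n) (F := F) []
      rw [perm_one]
      simpa using this
  | succ m ih =>
    rcases exists_descent (σ := σ) (by omega) with ⟨k, hk⟩ | ⟨k, hk⟩
    · obtain ⟨u, w, h1, h2⟩ := ih (simple k * σ) (by omega)
      refine ⟨u.trans (Equiv.swap (lo k) (hi k)), w, ?_, ?_⟩
      · rw [← perm_mul]
        rw [supp_simple_mul, show rk (simple k * σ) = rk σ from rk_perm_mul _ _] at h1
        rw [← h1]
        simp only [simple, mul_assoc]
      · have := weylLength_mul_simple_le (F := F) k u
        rw [← perm_mul]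
        rw [simple] at this
        omega
    · obtain ⟨u, w, h1, h2⟩ := ih (σ * simple k) (by omega)
      refine ⟨u, (Equiv.swap (lo k) (hi k)).trans w, ?_, ?_⟩
      · rw [← perm_mul]
        rw [supp_mul_simple, rk_mul_simple] at h1
        rw [← h1]
        simp only [simple, mul_assoc]
      · have := weylLength_simple_mul_le (F := F) k w
        rw [← perm_mul]
        rw [simple] at this
        omega

/-- Following descents down to length zero gives an admissible pair (u, w) of total length at most
`len σ`. Conversely each simple factor lowers `len` by at most 1, and powers of ν have `len` zero,
so no pair is shorter. -/
theorem length_eq_len (σ : Q n F) : length σ = len σ := by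
  obtain ⟨u, w, h1, h2⟩ := exists_perm_weylLength_le _ σ rfl
  refine le_antisymm (le_trans (Nat.sInf_le ⟨u, w, h1, rfl⟩) h2) ?_
  refine le_csInf ⟨_, u, w, h1, rfl⟩ ?_
  rintro m ⟨u, w, h, rfl⟩
  obtain ⟨l, hl, hu⟩ := exists_list_weylLength (F := F) u
  obtain ⟨l', hl', hw⟩ := exists_list_weylLength (F := F) w
  have h3 := len_le_list_mul l (supp σ)
  have h4 := len_le_mul_list l' ((l.map simple).prod * supp σ)
  rw [hu, hw, h, len_nu_pow] at h4
  rw [hu, len_supp] at h3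
  omega

end Length

/-! ### The group of unitriangular matrices -/

section Unitriangular

variable {n : ℕ} {F : Type*} [Field F]

theorem one_mem_U : (1 : Matrix (Fin n) (Fin n) F) ∈ U n F :=
  ⟨fun i => Matrix.one_apply_eq i, fun _ _ h => Matrix.one_apply_ne h.ne'⟩

theorem mul_mem_U {u v : Matrix (Fin n) (Fin n) F} (hu : u ∈ U n F) (hv : v ∈ U n F) :
    u * v ∈ U n F := by
  constructor
  · intro i
    rw [Matrix.mul_apply, Finset.sum_eq_single i, hu.1, hv.1, one_mul]
    · intro l _ hl
      rcases lt_or_gt_of_ne hl with h | h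
      · rw [hu.2 _ _ h, zero_mul]
      · rw [hv.2 _ _ h, mul_zero]
    · simp
  · intro i j hij
    rw [Matrix.mul_apply]
    refine Finset.sum_eq_zero fun l _ => ?_
    rcases lt_or_ge l i with h | h
    · rw [hu.2 _ _ h, zero_mul]
    · rw [hv.2 _ _ (hij.trans_le h), mul_zero]

theorem isUnit_of_mem_U {u : Matrix (Fin n) (Fin n) F} (hu : u ∈ U n F) : IsUnit u := by
  rw [Matrix.isUnit_iff_isUnit_det, Matrix.det_of_isUpperTriangular fun i j h => hu.2 i j h]
  simp [hu.1]

theorem mul_inv_of_mem_U {u : Matrix (Fin n) (Fin n) F} (hu : u ∈ U n F) : u * u⁻¹ = 1 :=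
  Matrix.mul_nonsing_inv _ ((Matrix.isUnit_iff_isUnit_det _).1 (isUnit_of_mem_U hu))

theorem inv_mul_of_mem_U {u : Matrix (Fin n) (Fin n) F} (hu : u ∈ U n F) : u⁻¹ * u = 1 :=
  Matrix.nonsing_inv_mul _ ((Matrix.isUnit_iff_isUnit_det _).1 (isUnit_of_mem_U hu))

theorem flipMat_mem_U {u : Matrix (Fin n) (Fin n) F} (hu : u ∈ U n F) : flipMat u ∈ U n F :=
  ⟨fun _ => hu.1 _, fun _ _ h => hu.2 _ _ (Fin.rev_lt_rev.2 h)⟩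

theorem sum_comp_of_injOn_of_mapsTo {α β : Type*} [AddCommMonoid β] {s : Finset α} {g : α → α}
    (hg : Set.InjOn g s) (hs : Set.MapsTo g s s) (f : α → β) :
    ∑ x ∈ s, f (g x) = ∑ x ∈ s, f x :=
  Finset.sum_nbij g hs hg (Finset.surjOn_of_injOn_of_card_le g hs hg le_rfl) fun _ _ => rfl

end Unitriangular

/-! ### The idempotent of U and sums over double cosets -/

section Idempotent

variable {n : ℕ} {F : Type*} [Field F]

/-- The element of the monoid algebra given by a matrix. -/
noncomputable def pt (x : Matrix (Fin n) (Fin n) F) : A n F := MonoidAlgebra.of ℚ _ x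

theorem pt_mul (x y : Matrix (Fin n) (Fin n) F) : pt (x * y) = pt x * pt y := map_mul _ _ _

theorem pt_one : pt (1 : Matrix (Fin n) (Fin n) F) = 1 := map_one _

open Classical in
theorem coeff_pt (x y : Matrix (Fin n) (Fin n) F) :
    (pt x).coeff y = if x = y then 1 else 0 := by
  rw [pt, MonoidAlgebra.of_apply, MonoidAlgebra.coeff_single, Finsupp.single_apply]

variable [Fintype F]

/-- The finite set of upper unitriangular matrices. -/
noncomputable def uFin (n : ℕ) (F : Type*) [Field F] [Fintype F] :
    Finset (Matrix (Fin n) (Fin n) F) := (Set.toFinite (U n F)).toFinset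

theorem mem_uFin {u : Matrix (Fin n) (Fin n) F} : u ∈ uFin n F ↔ u ∈ U n F := by
  simp [uFin]

/-- Multiplication by u is an injection of the finite set U into itself, so it reaches 1; this keeps
inverses inside U without computing them. -/
theorem exists_mul_eq_one_of_mem_U {u : Matrix (Fin n) (Fin n) F} (hu : u ∈ U n F) :
    ∃ v ∈ U n F, u * v = 1 ∧ v * u = 1 := by
  have h1 : Set.MapsTo (u * ·) (uFin n F : Set (Matrix (Fin n) (Fin n) F)) (uFin n F) :=
    fun v hv => mem_uFin.2 (mul_mem_U hu (mem_uFin.1 hv))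
  obtain ⟨v, hv, huv⟩ := Finset.surjOn_of_injOn_of_card_le _ h1
    ((isUnit_of_mem_U hu).mul_right_injective.injOn) le_rfl (mem_uFin.2 one_mem_U)
  exact ⟨v, mem_uFin.1 hv, huv, mul_eq_one_comm.1 huv⟩

theorem inv_mem_U {u : Matrix (Fin n) (Fin n) F} (hu : u ∈ U n F) : u⁻¹ ∈ U n F := by
  obtain ⟨v, hv, h, -⟩ := exists_mul_eq_one_of_mem_U hu
  rwa [Matrix.inv_eq_right_inv h]

/-- The idempotent `|U|⁻¹ ∑ u` of the monoid algebra. -/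
noncomputable def eps (n : ℕ) (F : Type*) [Field F] [Fintype F] : A n F :=
  ((uFin n F).card : ℚ)⁻¹ • ∑ u ∈ uFin n F, pt u

theorem card_uFin_ne_zero : ((uFin n F).card : ℚ) ≠ 0 :=
  Nat.cast_ne_zero.2 (Finset.card_ne_zero_of_mem (mem_uFin.2 one_mem_U))

theorem pt_mul_eps {u : Matrix (Fin n) (Fin n) F} (hu : u ∈ U n F) : pt u * eps n F = eps n F := by
  rw [eps, mul_smul_comm, Finset.mul_sum]
  simp_rw [← pt_mul]
  rw [sum_comp_of_injOn_of_mapsTo (isUnit_of_mem_U hu).mul_right_injective.injOn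
    fun v hv => mem_uFin.2 (mul_mem_U hu (mem_uFin.1 hv))]

theorem eps_mul_pt {u : Matrix (Fin n) (Fin n) F} (hu : u ∈ U n F) : eps n F * pt u = eps n F := by
  rw [eps, smul_mul_assoc, Finset.sum_mul]
  simp_rw [← pt_mul]
  rw [sum_comp_of_injOn_of_mapsTo (isUnit_of_mem_U hu).mul_left_injective.injOn
    fun v hv => mem_uFin.2 (mul_mem_U (mem_uFin.1 hv) hu)]

theorem eps_mul_of_forall {a : A n F} (h : ∀ u ∈ U n F, pt u * a = a) : eps n F * a = a := by
  rw [eps, smul_mul_assoc, Finset.sum_mul, Finset.sum_congr rfl fun u hu => h u (mem_uFin.1 hu),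
    Finset.sum_const, ← Nat.cast_smul_eq_nsmul ℚ, smul_smul, inv_mul_cancel₀ card_uFin_ne_zero,
    one_smul]

theorem mul_eps_of_forall {a : A n F} (h : ∀ u ∈ U n F, a * pt u = a) : a * eps n F = a := by
  rw [eps, mul_smul_comm, Finset.mul_sum, Finset.sum_congr rfl fun u hu => h u (mem_uFin.1 hu),
    Finset.sum_const, ← Nat.cast_smul_eq_nsmul ℚ, smul_smul, inv_mul_cancel₀ card_uFin_ne_zero,
    one_smul]

theorem eps_mul_eps : eps n F * eps n F = eps n F := eps_mul_of_forall fun _ => pt_mul_eps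

/-- The average `ε x ε` of `x` over `U × U`. -/
noncomputable def av (x : Matrix (Fin n) (Fin n) F) : A n F := eps n F * pt x * eps n F

theorem av_mul_left {u : Matrix (Fin n) (Fin n) F} (hu : u ∈ U n F)
    (x : Matrix (Fin n) (Fin n) F) : av (u * x) = av x := by
  rw [av, av, pt_mul, ← mul_assoc (eps n F), eps_mul_pt hu]

theorem av_mul_right {u : Matrix (Fin n) (Fin n) F} (hu : u ∈ U n F)
    (x : Matrix (Fin n) (Fin n) F) : av (x * u) = av x := by
  rw [av, av, pt_mul, mul_assoc, mul_assoc, pt_mul_eps hu, mul_assoc]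

/-- The finite set `U σ U`. -/
noncomputable def cosetFin (σ : Q n F) : Finset (Matrix (Fin n) (Fin n) F) :=
  (Set.toFinite (doubleCoset σ)).toFinset

theorem mem_cosetFin {σ : Q n F} {x : Matrix (Fin n) (Fin n) F} :
    x ∈ cosetFin σ ↔ ∃ u ∈ U n F, ∃ v ∈ U n F, x = u * σ * v := by
  simp [cosetFin, doubleCoset]

theorem self_mem_cosetFin (σ : Q n F) : (σ : Matrix (Fin n) (Fin n) F) ∈ cosetFin σ :=
  mem_cosetFin.2 ⟨1, one_mem_U, 1, one_mem_U, by rw [one_mul, mul_one]⟩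

theorem cosetSum_def (σ : Q n F) : cosetSum σ = ∑ x ∈ cosetFin σ, pt x := rfl

/-- The sum over UσU is invariant under U on both sides, hence fixed by ε on both sides, while all
its terms have the same average. -/
theorem cosetSum_eq_smul_av (σ : Q n F) :
    cosetSum σ = ((cosetFin σ).card : ℚ) • av (σ : Matrix (Fin n) (Fin n) F) := by
  have h1 : eps n F * cosetSum σ = cosetSum σ := by
    refine eps_mul_of_forall fun u hu => ?_
    rw [cosetSum_def, Finset.mul_sum]
    simp_rw [← pt_mul]
    refine sum_comp_of_injOn_of_mapsTo (isUnit_of_mem_U hu).mul_right_injective.injOn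
      (fun x hx => ?_) _
    obtain ⟨v, hv, w, hw, rfl⟩ := mem_cosetFin.1 hx
    exact mem_cosetFin.2 ⟨u * v, mul_mem_U hu hv, w, hw, by simp only [mul_assoc]⟩
  have h2 : cosetSum σ * eps n F = cosetSum σ := by
    refine mul_eps_of_forall fun u hu => ?_
    rw [cosetSum_def, Finset.sum_mul]
    simp_rw [← pt_mul]
    refine sum_comp_of_injOn_of_mapsTo (isUnit_of_mem_U hu).mul_left_injective.injOn
      (fun x hx => ?_) _
    obtain ⟨v, hv, w, hw, rfl⟩ := mem_cosetFin.1 hx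
    exact mem_cosetFin.2 ⟨v, hv, w * u, mul_mem_U hw hu, by simp only [mul_assoc]⟩
  have h3 : eps n F * cosetSum σ * eps n F = ∑ x ∈ cosetFin σ, av x := by
    rw [cosetSum_def, Finset.mul_sum, Finset.sum_mul]
    rfl
  rw [h1, h2] at h3
  rw [h3, Nat.cast_smul_eq_nsmul, ← Finset.sum_const]
  refine Finset.sum_congr rfl fun x hx => ?_
  obtain ⟨v, hv, w, hw, rfl⟩ := mem_cosetFin.1 hx
  rw [av_mul_right hw, av_mul_left hv]

open Classical in
theorem coeff_cosetSum (σ : Q n F) (x : Matrix (Fin n) (Fin n) F) :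
    (cosetSum σ).coeff x = if x ∈ cosetFin σ then 1 else 0 := by
  rw [cosetSum_def, MonoidAlgebra.coeff_sum, Finsupp.finsetSum_apply]
  simp_rw [coeff_pt]
  simp

open Classical in
/-- The pairs `(u, v)` in `U × U` with `u σ = σ v`. -/
noncomputable def stabFin (σ : Q n F) :
    Finset (Matrix (Fin n) (Fin n) F × Matrix (Fin n) (Fin n) F) :=
  (uFin n F ×ˢ uFin n F).filter fun p => p.1 * (σ : Matrix (Fin n) (Fin n) F) = σ * p.2

theorem mem_stabFin {σ : Q n F} {p : Matrix (Fin n) (Fin n) F × Matrix (Fin n) (Fin n) F} :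
    p ∈ stabFin σ ↔ p.1 ∈ U n F ∧ p.2 ∈ U n F ∧
      p.1 * (σ : Matrix (Fin n) (Fin n) F) = σ * p.2 := by
  simp [stabFin, mem_uFin, and_assoc]

/-- Orbit–stabilizer for U × U, read off by comparing the coefficients of σ in |U|² εσε = ∑ uσv. The
substitution v ↦ v⁻¹ turns uσv = σ into uσ = σv. -/
theorem card_cosetFin_mul_card_stabFin (σ : Q n F) :
    (cosetFin σ).card * (stabFin σ).card = (uFin n F).card ^ 2 := by
  classical
  have h1 : ((uFin n F).card : ℚ) ^ 2 • av (σ : Matrix (Fin n) (Fin n) F) =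
      ∑ p ∈ uFin n F ×ˢ uFin n F, pt (p.1 * (σ : Matrix (Fin n) (Fin n) F) * p.2) := by
    rw [av, eps, Finset.sum_product]
    simp_rw [pt_mul, ← Finset.mul_sum, ← Finset.sum_mul]
    rw [smul_mul_assoc, smul_mul_assoc, mul_smul_comm, smul_smul, smul_smul]
    have := card_uFin_ne_zero (n := n) (F := F)
    rw [show ((uFin n F).card : ℚ) ^ 2 * ((uFin n F).card : ℚ)⁻¹ * ((uFin n F).card : ℚ)⁻¹ = 1 by
      field_simp, one_smul]
  have h2 : (((uFin n F ×ˢ uFin n F).filter fun p =>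
      p.1 * (σ : Matrix (Fin n) (Fin n) F) * p.2 = σ).card : ℚ) * (cosetFin σ).card =
        (uFin n F).card ^ 2 := by
    have h3 := congrArg (fun a => (((cosetFin σ).card : ℚ) • a).coeff (σ : Matrix _ _ F)) h1
    simp only [smul_comm _ (_ ^ 2 : ℚ), ← cosetSum_eq_smul_av] at h3
    rw [MonoidAlgebra.coeff_smul_apply, MonoidAlgebra.coeff_smul_apply, coeff_cosetSum,
      if_pos (self_mem_cosetFin σ), MonoidAlgebra.coeff_sum, Finsupp.finsetSum_apply] at h3
    simp_rw [coeff_pt] at h3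
    rw [Finset.sum_boole] at h3
    simp only [smul_eq_mul, mul_one] at h3
    rw [h3, mul_comm]
  have h4 : (stabFin σ).card = ((uFin n F ×ˢ uFin n F).filter fun p =>
      p.1 * (σ : Matrix (Fin n) (Fin n) F) * p.2 = σ).card := by
    have hinv : ∀ v ∈ U n F, v⁻¹⁻¹ = v := fun v hv =>
      Matrix.inv_eq_right_inv (inv_mul_of_mem_U hv)
    refine Finset.card_bij' (fun p _ => (p.1, p.2⁻¹)) (fun p _ => (p.1, p.2⁻¹)) ?_ ?_ ?_ ?_
    · intro p hp
      obtain ⟨h5, h6, h7⟩ := mem_stabFin.1 hp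
      rw [Finset.mem_filter, Finset.mem_product, mem_uFin, mem_uFin]
      exact ⟨⟨h5, inv_mem_U h6⟩, by
        simp only; rw [h7, mul_assoc, mul_inv_of_mem_U h6, mul_one]⟩
    · intro p hp
      rw [Finset.mem_filter, Finset.mem_product, mem_uFin, mem_uFin] at hp
      refine mem_stabFin.2 ⟨hp.1.1, inv_mem_U hp.1.2, ?_⟩
      conv_rhs => rw [← hp.2]
      rw [mul_assoc, mul_inv_of_mem_U hp.1.2, mul_one]
    · intro p hp
      exact Prod.ext rfl (hinv _ (mem_stabFin.1 hp).2.1)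
    · intro p hp
      rw [Finset.mem_filter, Finset.mem_product, mem_uFin, mem_uFin] at hp
      exact Prod.ext rfl (hinv _ hp.1.2)
  rw [h4, mul_comm]
  exact_mod_cast h2

end Idempotent

/-! ### The size of a double coset -/

section Counting

variable {n : ℕ} {F : Type*} [Field F]

theorem two_mul_card_pairs_lt (s : Finset (Fin n)) :
    2 * ((s ×ˢ s).filter fun p => p.1 < p.2).card + s.card = s.card ^ 2 := by
  have h1 : ((s ×ˢ s).filter fun p => p.1 < p.2).card =
      ((s ×ˢ s).filter fun p => p.2 < p.1).card := by
    refine Finset.card_bij' (fun p _ => p.swap) (fun p _ => p.swap) ?_ ?_ (fun _ _ => rfl)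
      (fun _ _ => rfl) <;> simp +contextual
  have h2 : ((s ×ˢ s).filter fun p => p.1 = p.2).card = s.card := by
    refine Finset.card_bij' (fun p _ => p.1) (fun a _ => (a, a)) ?_ ?_ ?_ ?_ <;>
      simp +contextual
  have h3 := Finset.card_filter_add_card_filter_not (s := s ×ˢ s) (p := fun p => p.1 < p.2)
  have h4 := Finset.card_filter_add_card_filter_not
    (s := (s ×ˢ s).filter fun p => ¬p.1 < p.2) (p := fun p => p.1 = p.2)
  rw [Finset.filter_filter, Finset.filter_filter] at h4
  have h5 : ((s ×ˢ s).filter fun p => ¬p.1 < p.2 ∧ p.1 = p.2) =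
      (s ×ˢ s).filter fun p => p.1 = p.2 :=
    Finset.filter_congr fun p _ => ⟨fun h => h.2, fun h => ⟨h.not_lt, h⟩⟩
  have h6 : ((s ×ˢ s).filter fun p => ¬p.1 < p.2 ∧ ¬p.1 = p.2) =
      (s ×ˢ s).filter fun p => p.2 < p.1 :=
    Finset.filter_congr fun p _ => ⟨fun h => lt_of_le_of_ne (not_lt.1 h.1) (Ne.symm h.2),
      fun h => ⟨h.not_gt, h.ne'⟩⟩
  rw [h5, h6, h2, ← h1] at h4
  rw [Finset.card_product] at h3
  rw [sq]
  omega

/-- The pairs `i < i'` that are not inversions of `rowVal σ`. -/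
noncomputable def rowFree (σ : Q n F) : Finset (Fin n × Fin n) :=
  Finset.univ.filter fun p => p.1 < p.2 ∧ ¬rowVal σ p.2 < rowVal σ p.1

open Classical in
/-- The pairs `j < j'` with column `j` of `σ` zero. -/
noncomputable def colFree (σ : Q n F) : Finset (Fin n × Fin n) :=
  Finset.univ.filter fun p => p.1 < p.2 ∧ p.1 ∉ cols σ

theorem mem_rowFree {σ : Q n F} {p : Fin n × Fin n} :
    p ∈ rowFree σ ↔ p.1 < p.2 ∧ ¬rowVal σ p.2 < rowVal σ p.1 := by
  simp [rowFree]

theorem mem_colFree {σ : Q n F} {p : Fin n × Fin n} :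
    p ∈ colFree σ ↔ p.1 < p.2 ∧ p.1 ∉ cols σ := by
  simp [colFree]

theorem card_rowFree_add (σ : Q n F) : (rowFree σ).card + (inversions (rowVal σ)).card =
    (Finset.univ.filter fun p : Fin n × Fin n => p.1 < p.2).card := by
  rw [← Finset.card_filter_add_card_filter_not
      (s := Finset.univ.filter fun p : Fin n × Fin n => p.1 < p.2)
      (p := fun p => rowVal σ p.2 < rowVal σ p.1),
    Finset.filter_filter, Finset.filter_filter, add_comm]
  rfl

open Classical in
theorem card_colFree_add (σ : Q n F) : (colFree σ).card + (colGaps σ).card +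
    (((Finset.univ.filter (· ∈ cols σ)) ×ˢ (Finset.univ.filter (· ∈ cols σ))).filter
      fun p => p.1 < p.2).card =
    (Finset.univ.filter fun p : Fin n × Fin n => p.1 < p.2).card := by
  rw [← Finset.card_filter_add_card_filter_not
      (s := Finset.univ.filter fun p : Fin n × Fin n => p.1 < p.2) (p := fun p => p.1 ∉ cols σ),
    ← Finset.card_filter_add_card_filter_not
      (s := Finset.filter (fun p : Fin n × Fin n => ¬p.1 ∉ cols σ) _) (p := fun p => p.2 ∉ cols σ),
    Finset.filter_filter, Finset.filter_filter, Finset.filter_filter, add_assoc]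
  congr 2
  · congr 1; ext p; simp [colGaps]
  · congr 1; ext p; simp only [Finset.mem_filter, Finset.mem_product, Finset.mem_univ, true_and]
    tauto

/-- The unitriangular matrix with prescribed entries in the positions above the diagonal. -/
def unitri (a : Fin n × Fin n → F) : Matrix (Fin n) (Fin n) F :=
  Matrix.of fun i j => if i = j then 1 else if i < j then a (i, j) else 0

theorem unitri_mem_U (a : Fin n × Fin n → F) : unitri a ∈ U n F :=
  ⟨fun i => by simp [unitri], fun i j h => by simp [unitri, h.ne', h.not_gt]⟩

theorem mul_coe_apply (u : Matrix (Fin n) (Fin n) F) (σ : Q n F) {i j : Fin n}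
    (h : entry σ i j ≠ 0) (l : Fin n) :
    (u * (σ : Matrix (Fin n) (Fin n) F)) l j = u l i * entry σ i j := by
  rw [Matrix.mul_apply, Finset.sum_eq_single i]
  · rfl
  · intro b _ hb
    by_contra h'
    exact hb (σ.2.2 _ _ _ (right_ne_zero_of_mul h') h)
  · simp

theorem mul_coe_apply_of_notMem (u : Matrix (Fin n) (Fin n) F) (σ : Q n F) {j : Fin n}
    (h : j ∉ cols σ) (l : Fin n) : (u * (σ : Matrix (Fin n) (Fin n) F)) l j = 0 := by
  rw [Matrix.mul_apply]
  refine Finset.sum_eq_zero fun b _ => ?_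
  by_contra h'
  exact h ⟨b, right_ne_zero_of_mul h'⟩

theorem coe_mul_apply (v : Matrix (Fin n) (Fin n) F) (σ : Q n F) {i j : Fin n}
    (h : entry σ i j ≠ 0) (l : Fin n) :
    ((σ : Matrix (Fin n) (Fin n) F) * v) i l = entry σ i j * v j l := by
  rw [Matrix.mul_apply, Finset.sum_eq_single j]
  · rfl
  · intro b _ hb
    by_contra h'
    exact hb (σ.2.1 _ _ _ (left_ne_zero_of_mul h') h)
  · simp

theorem coe_mul_apply_of_notMem (v : Matrix (Fin n) (Fin n) F) (σ : Q n F) {i : Fin n}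
    (h : i ∉ rows σ) (l : Fin n) : ((σ : Matrix (Fin n) (Fin n) F) * v) i l = 0 := by
  rw [Matrix.mul_apply]
  refine Finset.sum_eq_zero fun b _ => ?_
  by_contra h'
  exact h ⟨b, left_ne_zero_of_mul h'⟩

/-- Compare the two sides in row i and in the column j' of the entry of row i'. On the right stands
either a zero row or an entry of v below the diagonal, so u must vanish there. -/
theorem eq_zero_of_inversion {σ : Q n F} {u v : Matrix (Fin n) (Fin n) F} (hv : v ∈ U n F)
    (h : u * (σ : Matrix (Fin n) (Fin n) F) = σ * v) {i i' : Fin n}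
    (hlt : rowVal σ i' < rowVal σ i) : u i i' = 0 := by
  obtain ⟨j', hj'⟩ := rowVal_lt_iff.1 (hlt.trans_le (rowVal_le σ i))
  have h1 := congrFun (congrFun h i) j'
  rw [mul_coe_apply u σ hj'] at h1
  refine (mul_eq_zero.1 (h1.trans ?_)).resolve_right hj'
  by_cases hi : i ∈ rows σ
  · obtain ⟨j, hj⟩ := hi
    rw [rowVal_of_entry_ne_zero hj', rowVal_of_entry_ne_zero hj] at hlt
    rw [coe_mul_apply v σ hj, hv.2 _ _ hlt, mul_zero]
  · exact coe_mul_apply_of_notMem v σ hi j'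

variable [Fintype F]

/-- The entries of u above the diagonal are free except at inversions. The rows of v indexed by
nonzero columns are then determined by u, and the other rows of v are free above the diagonal. -/
theorem card_stabFin (σ : Q n F) :
    (stabFin σ).card = Fintype.card F ^ ((rowFree σ).card + (colFree σ).card) := by
  classical
  have h0 : Fintype.card (({p // p ∈ rowFree σ} → F) × ({p // p ∈ colFree σ} → F)) =
      Fintype.card F ^ ((rowFree σ).card + (colFree σ).card) := by
    rw [Fintype.card_prod, Fintype.card_fun, Fintype.card_fun, Fintype.card_coe,
      Fintype.card_coe, pow_add]
  rw [← h0, ← Finset.card_univ]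
  refine Finset.card_bij (fun p _ => (fun x => p.1 x.1.1 x.1.2, fun x => p.2 x.1.1 x.1.2))
    (fun _ _ => Finset.mem_univ _) ?_ ?_
  · rintro ⟨u, v⟩ h ⟨u', v'⟩ h' heq
    obtain ⟨hu, hv, huv⟩ := mem_stabFin.1 h
    obtain ⟨hu', hv', huv'⟩ := mem_stabFin.1 h'
    simp only at hu hv huv hu' hv' huv'
    rw [Prod.mk.injEq] at heq
    have e1 : u = u' := by
      ext i j
      rcases lt_trichotomy i j with hij | rfl | hij
      · by_cases hlt : rowVal σ j < rowVal σ i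
        · rw [eq_zero_of_inversion hv huv hlt, eq_zero_of_inversion hv' huv' hlt]
        · exact congrFun heq.1 ⟨(i, j), mem_rowFree.2 ⟨hij, hlt⟩⟩
      · rw [hu.1, hu'.1]
      · rw [hu.2 _ _ hij, hu'.2 _ _ hij]
    subst e1
    refine Prod.ext rfl (Matrix.ext fun j l => ?_)
    simp only
    by_cases hj : j ∈ cols σ
    · obtain ⟨i, hi⟩ := hj
      have h1 := congrFun (congrFun (huv.symm.trans huv') i) l
      rw [coe_mul_apply v σ hi, coe_mul_apply v' σ hi] at h1
      exact mul_left_cancel₀ hi h1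
    · rcases lt_trichotomy j l with hij | rfl | hij
      · exact congrFun heq.2 ⟨(j, l), mem_colFree.2 ⟨hij, hj⟩⟩
      · rw [hv.1, hv'.1]
      · rw [hv.2 _ _ hij, hv'.2 _ _ hij]
  · rintro ⟨a, b⟩ -
    set u := unitri fun p => if hp : p ∈ rowFree σ then a ⟨p, hp⟩ else 0 with hu
    have huU : u ∈ U n F := unitri_mem_U _
    have hu0 : ∀ {i i'}, rowVal σ i' < rowVal σ i → u i i' = 0 := by
      intro i i' hlt
      have hne : i ≠ i' := by rintro rfl; exact hlt.false
      have hnf : (i, i') ∉ rowFree σ := fun h => (mem_rowFree.1 h).2 hlt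
      simp [hu, unitri, hne, hnf]
    -- A row of v indexed by a nonzero column is solved for from uσ = σv; the vanishing of u at
    -- inversions is what makes it unitriangular.
    let v : Matrix (Fin n) (Fin n) F := Matrix.of fun j l =>
      if j ∈ cols σ then
        (entry σ ((hat σ).symm j) j)⁻¹ * (u * (σ : Matrix (Fin n) (Fin n) F)) ((hat σ).symm j) l
      else unitri (fun p => if hp : p ∈ colFree σ then b ⟨p, hp⟩ else 0) j l
    have hv1 : ∀ {i j}, entry σ i j ≠ 0 → ∀ l,
        v j l = (entry σ i j)⁻¹ * (u * (σ : Matrix (Fin n) (Fin n) F)) i l := by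
      intro i j hij l
      have h1 : (hat σ).symm j = i := (Equiv.symm_apply_eq _).2 (hat_of_entry_ne_zero σ hij).symm
      simp only [v, Matrix.of_apply]
      rw [if_pos ⟨i, hij⟩, h1]
    have hv2 : ∀ {j}, j ∉ cols σ → ∀ l,
        v j l = unitri (fun p => if hp : p ∈ colFree σ then b ⟨p, hp⟩ else 0) j l := by
      intro j hj l
      simp only [v, Matrix.of_apply]
      rw [if_neg hj]
    have hvU : v ∈ U n F := by
      constructor
      · intro j
        by_cases hj : j ∈ cols σ
        · obtain ⟨i, hi⟩ := hj
          rw [hv1 hi, mul_coe_apply u σ hi, huU.1, one_mul, inv_mul_cancel₀ hi]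
        · rw [hv2 hj, (unitri_mem_U _).1]
      · intro j l hlj
        by_cases hj : j ∈ cols σ
        · obtain ⟨i, hi⟩ := hj
          rw [hv1 hi]
          by_cases hl : l ∈ cols σ
          · obtain ⟨i', hi'⟩ := hl
            rw [mul_coe_apply u σ hi', hu0, zero_mul, mul_zero]
            rwa [rowVal_of_entry_ne_zero hi, rowVal_of_entry_ne_zero hi']
          · rw [mul_coe_apply_of_notMem u σ hl, mul_zero]
        · rw [hv2 hj, (unitri_mem_U _).2 _ _ hlj]
    refine ⟨(u, v), mem_stabFin.2 ⟨huU, hvU, ?_⟩, Prod.ext (funext ?_) (funext ?_)⟩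
    · ext i l
      simp only
      by_cases hi : i ∈ rows σ
      · obtain ⟨j, hj⟩ := hi
        rw [coe_mul_apply v σ hj, hv1 hj, mul_inv_cancel_left₀ hj]
      · rw [coe_mul_apply_of_notMem v σ hi]
        by_cases hl : l ∈ cols σ
        · obtain ⟨i', hi'⟩ := hl
          rw [mul_coe_apply u σ hi', hu0, zero_mul]
          rw [rowVal_of_notMem hi]
          exact rowVal_lt_iff.2 ⟨l, hi'⟩
        · exact mul_coe_apply_of_notMem u σ hl i
    · rintro ⟨⟨i, j⟩, hp⟩
      have hij := (mem_rowFree.1 hp).1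
      simp only at hij
      simp [hu, unitri, hij.ne, hij, hp]
    · rintro ⟨⟨i, j⟩, hp⟩
      have hij := mem_colFree.1 hp
      simp only at hij
      simp only
      rw [hv2 hij.2]
      simp [unitri, hij.1.ne, hij.1, hp]

theorem card_uFin_sq : (uFin n F).card ^ 2 =
    Fintype.card F ^ (2 * (Finset.univ.filter fun p : Fin n × Fin n => p.1 < p.2).card) := by
  classical
  -- For the zero matrix the stabilizer is all of U × U and there are no constraints, so the general
  -- count yields |U|².
  let z : Q n F := ⟨0, fun _ _ _ h => absurd rfl h, fun _ _ _ h => absurd rfl h⟩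
  have hr : ∀ i, rowVal z i = n := fun i => rowVal_of_notMem fun ⟨_, h⟩ => h rfl
  have hc : ∀ j, j ∉ cols z := fun j ⟨_, h⟩ => h rfl
  have h1 : rowFree z = Finset.univ.filter fun p : Fin n × Fin n => p.1 < p.2 := by
    ext p; simp [mem_rowFree, hr]
  have h2 : colFree z = Finset.univ.filter fun p : Fin n × Fin n => p.1 < p.2 := by
    ext p; simp [mem_colFree, hc]
  have h3 : stabFin z = uFin n F ×ˢ uFin n F := by
    ext p; simp [mem_stabFin, mem_uFin, z]
  have h4 := card_stabFin z
  rw [h1, h2, h3, Finset.card_product, ← sq, ← two_mul] at h4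
  exact h4

/-- Here m = r(r-1)/2 counts the pairs of nonzero columns. Dividing |U|² by the stabilizer leaves as
exponent the inversions, the gaps and these pairs. -/
theorem card_cosetFin (σ : Q n F) : ∃ m : ℕ, 2 * m + rk σ = rk σ ^ 2 ∧
    (cosetFin σ).card = Fintype.card F ^ (len σ + m) := by
  classical
  refine ⟨_, by rw [rk_eq_card_cols]; exact two_mul_card_pairs_lt _, ?_⟩
  have h1 := card_cosetFin_mul_card_stabFin σ
  have h2 := card_rowFree_add σ
  have h3 := card_colFree_add σ
  rw [card_uFin_sq, card_stabFin] at h1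
  refine mul_right_cancel₀ (pow_ne_zero _ (Fintype.card_ne_zero (α := F))) (h1.trans ?_)
  rw [← pow_add, len]
  congr 1
  omega

theorem card_ne_zero_rat : (Fintype.card F : ℚ) ≠ 0 := Nat.cast_ne_zero.2 Fintype.card_ne_zero

theorem T_eq_smul_av (σ : Q n F) :
    T σ = (Fintype.card F : ℚ) ^ len σ • av (σ : Matrix (Fin n) (Fin n) F) := by
  obtain ⟨m, hm, hc⟩ := card_cosetFin σ
  rw [T, cosetSum_eq_smul_av, smul_smul, hc, Nat.cast_pow]
  congr 1
  -- The product r(1-r) is even, so the integer division is exact and the rank power of q cancels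
  -- against q^m.
  have h1 : ((rk σ : ℤ) * (1 - (rk σ : ℤ))) / 2 = -(m : ℤ) := by
    have h2 : 2 * (m : ℤ) + rk σ = (rk σ : ℤ) ^ 2 := by exact_mod_cast hm
    rw [show (rk σ : ℤ) * (1 - (rk σ : ℤ)) = -(m : ℤ) * 2 by linear_combination h2]
    exact Int.mul_ediv_cancel _ (by norm_num)
  rw [h1, pow_add, zpow_neg, zpow_natCast, mul_comm, mul_assoc,
    mul_inv_cancel₀ (pow_ne_zero _ card_ne_zero_rat), mul_one]

end Counting

/-! ### Commutation past σ, ν and the torus, and reflection of the algebra -/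

section Products

variable {n : ℕ} {F : Type*} [Field F]

theorem transvection_mem_U {i j : Fin n} (h : i < j) (c : F) :
    Matrix.transvection i j c ∈ U n F := by
  constructor
  · intro l
    rw [Matrix.transvection, Matrix.add_apply, Matrix.one_apply_eq, Matrix.single_apply_of_ne,
      add_zero]
    rintro ⟨rfl, rfl⟩
    exact h.false
  · intro a b hab
    rw [Matrix.transvection, Matrix.add_apply, Matrix.one_apply_ne hab.ne',
      Matrix.single_apply_of_ne, add_zero]
    rintro ⟨rfl, rfl⟩
    exact hab.not_gt h

/-- Adding c times row i' to row i does nothing if row i' is zero. Otherwise it is the column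
operation adding a multiple of column j to column j', where j < j' are the columns of the two
entries, so it is unitriangular on the right. -/
theorem exists_transvection_mul_eq {σ : Q n F} {i i' : Fin n} (hne : i ≠ i')
    (h : rowVal σ i ≤ rowVal σ i') (c : F) :
    ∃ u ∈ U n F, Matrix.transvection i i' c * (σ : Matrix (Fin n) (Fin n) F) = σ * u := by
  by_cases hi' : i' ∈ rows σ
  · obtain ⟨j, hj⟩ := rowVal_lt_iff.1 (h.trans_lt (rowVal_lt_iff.2 hi'))
    obtain ⟨j', hj'⟩ := hi'
    rw [rowVal_of_entry_ne_zero hj, rowVal_of_entry_ne_zero hj'] at h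
    have hjj : j ≠ j' := by
      rintro rfl
      exact hne (σ.2.2 _ _ _ hj hj')
    refine ⟨_, transvection_mem_U (lt_of_le_of_ne h hjj) (c * entry σ i' j' / entry σ i j), ?_⟩
    have h1 : ∀ a, a ≠ i → (σ : Matrix (Fin n) (Fin n) F) a j = 0 := fun a ha => by
      by_contra h'
      exact ha (σ.2.2 _ _ _ h' hj)
    have h2 : ∀ b, b ≠ j' → (σ : Matrix (Fin n) (Fin n) F) i' b = 0 := fun b hb => by
      by_contra h'
      exact hb (σ.2.1 _ _ _ h' hj')
    ext a b
    by_cases ha : a = i <;> by_cases hb : b = j'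
    · subst ha hb
      rw [Matrix.transvection_mul_apply_same, Matrix.mul_transvection_apply_same]
      congr 1
      exact (div_mul_cancel₀ _ hj).symm
    · subst ha
      rw [Matrix.transvection_mul_apply_same, Matrix.mul_transvection_apply_of_ne _ _ _ _ hb,
        h2 b hb, mul_zero, add_zero]
    · subst hb
      rw [Matrix.transvection_mul_apply_of_ne _ _ _ _ ha, Matrix.mul_transvection_apply_same,
        h1 a ha, mul_zero, add_zero]
    · rw [Matrix.transvection_mul_apply_of_ne _ _ _ _ ha,
        Matrix.mul_transvection_apply_of_ne _ _ _ _ hb]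
  · refine ⟨1, one_mem_U, ?_⟩
    rw [mul_one]
    ext a b
    by_cases ha : a = i
    · subst ha
      have h1 : (σ : Matrix (Fin n) (Fin n) F) i' b = 0 := by
        by_contra h'
        exact hi' ⟨b, h'⟩
      rw [Matrix.transvection_mul_apply_same, h1, mul_zero, add_zero]
    · rw [Matrix.transvection_mul_apply_of_ne _ _ _ _ ha]

theorem simple_mul_apply (k : Fin (n - 1)) (x : Matrix (Fin n) (Fin n) F) (i j : Fin n) :
    (((simple k : Q n F) : Matrix (Fin n) (Fin n) F) * x) i j =
      x (Equiv.swap (lo k) (hi k) i) j := by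
  rw [Matrix.mul_apply, Finset.sum_eq_single (Equiv.swap (lo k) (hi k) i)]
  · simp [simple, perm]
  · intro b _ hb
    simp [simple, perm, hb.symm]
  · simp

theorem mul_simple_apply (k : Fin (n - 1)) (x : Matrix (Fin n) (Fin n) F) (i j : Fin n) :
    (x * ((simple k : Q n F) : Matrix (Fin n) (Fin n) F)) i j =
      x i (Equiv.swap (lo k) (hi k) j) := by
  rw [Matrix.mul_apply, Finset.sum_eq_single (Equiv.swap (lo k) (hi k) j)]
  · simp [simple, perm]
  · intro b _ hb
    have : Equiv.swap (lo k) (hi k) b ≠ j := by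
      rintro rfl
      simp at hb
    simp [simple, perm, this]
  · simp

theorem coe_simple_mul_simple (k : Fin (n - 1)) :
    ((simple k : Q n F) : Matrix (Fin n) (Fin n) F) * (simple k : Q n F) = 1 :=
  congrArg Subtype.val (simple_mul_simple (F := F) k)

/-- The Bruhat decomposition of the 2 × 2 matrix with rows (0, 1) and (1, r). The sign in h_k(r) is
there because s_k has determinant -1. -/
theorem simple_mul_transvection (k : Fin (n - 1)) (r : Fˣ) :
    ((simple k : Q n F) : Matrix (Fin n) (Fin n) F) * Matrix.transvection (lo k) (hi k) (r : F) =
      Matrix.transvection (lo k) (hi k) ((r⁻¹ : Fˣ) : F) *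
        (((h k r : Q n F) : Matrix (Fin n) (Fin n) F) *
          Matrix.transvection (hi k) (lo k) ((r⁻¹ : Fˣ) : F)) := by
  have hne := lo_ne_hi k
  have hd : ∀ (y : Matrix (Fin n) (Fin n) F) (i j : Fin n),
      (((h k r : Q n F) : Matrix (Fin n) (Fin n) F) * y) i j =
        ((if i = lo k then -r⁻¹ else if i = hi k then r else 1 : Fˣ) : F) * y i j :=
    fun y i j => Matrix.diagonal_mul _ _ _ _
  ext i j
  rw [simple_mul_apply]
  by_cases hi1 : i = lo k
  · subst hi1
    rw [Matrix.transvection_mul_apply_same, hd, hd, Equiv.swap_apply_left]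
    by_cases hj1 : j = lo k
    · subst hj1
      simp [Matrix.transvection, hne, hne.symm]
    · by_cases hj2 : j = hi k
      · subst hj2
        simp [Matrix.transvection, hne, hne.symm]
      · simp [Matrix.transvection, hne, Ne.symm hj1, Ne.symm hj2]
  · rw [Matrix.transvection_mul_apply_of_ne _ _ _ _ hi1, hd]
    by_cases hi2 : i = hi k
    · subst hi2
      rw [Equiv.swap_apply_right]
      by_cases hj1 : j = lo k
      · subst hj1
        simp [Matrix.transvection, hne.symm]
      · by_cases hj2 : j = hi k
        · subst hj2
          simp [Matrix.transvection, hne, hne.symm]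
        · simp [Matrix.transvection, Ne.symm hj1, Ne.symm hj2]
    · rw [Equiv.swap_apply_of_ne_of_ne hi1 hi2]
      simp [Matrix.transvection, Matrix.one_apply, hi1, hi2,
        Ne.symm hi1, Ne.symm hi2]

theorem simple_mul_mul_simple_mem_U (k : Fin (n - 1)) {y : Matrix (Fin n) (Fin n) F}
    (hy : y ∈ U n F) (h0 : y (lo k) (hi k) = 0) :
    ((simple k : Q n F) : Matrix (Fin n) (Fin n) F) * y * (simple k : Q n F) ∈ U n F := by
  constructor
  · intro i
    rw [mul_simple_apply, simple_mul_apply, hy.1]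
  · intro i j hij
    rw [mul_simple_apply, simple_mul_apply]
    by_cases h1 : j = lo k ∧ i = hi k
    · rw [h1.1, h1.2, Equiv.swap_apply_left, Equiv.swap_apply_right, h0]
    · refine hy.2 _ _ ((swap_lt_swap_iff k j i h1 ?_).2 hij)
      rintro ⟨rfl, rfl⟩
      exact hij.not_gt (lo_lt_hi k)

theorem exists_diag_mul_eq (t : Fin n → Fˣ) {u : Matrix (Fin n) (Fin n) F} (hu : u ∈ U n F) :
    ∃ v ∈ U n F, ((diag t : Q n F) : Matrix (Fin n) (Fin n) F) * u = v * (diag t : Q n F) := by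
  refine ⟨Matrix.of fun i j => t i * u i j * ((t j)⁻¹ : Fˣ), ⟨fun i => ?_, fun i j h => ?_⟩, ?_⟩
  · simp [hu.1]
  · simp [hu.2 _ _ h]
  · ext i j
    have h1 := Matrix.diagonal_mul (fun i => (t i : F)) u i j
    have h2 := Matrix.mul_diagonal (fun i => (t i : F))
      (Matrix.of fun i j => (t i : F) * u i j * ((t j)⁻¹ : Fˣ)) i j
    refine h1.trans (Eq.trans ?_ h2.symm)
    simp

theorem nu_mul_apply (x : Matrix (Fin n) (Fin n) F) (i j : Fin n) :
    (((nu : Q n F) : Matrix (Fin n) (Fin n) F) * x) i j =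
      if h : (i : ℕ) + 1 < n then x ⟨i + 1, h⟩ j else 0 := by
  rw [Matrix.mul_apply]
  split_ifs with h
  · rw [Finset.sum_eq_single (⟨i + 1, h⟩ : Fin n)]
    · simp [nu]
    · intro b _ hb
      have : ¬(b : ℕ) = i + 1 := fun h' => hb (Fin.ext h')
      simp [nu, this]
    · simp
  · refine Finset.sum_eq_zero fun b _ => ?_
    have : ¬(b : ℕ) = i + 1 := by omega
    simp [nu, this]

theorem mul_nu_apply (x : Matrix (Fin n) (Fin n) F) (i j : Fin n) :
    (x * ((nu : Q n F) : Matrix (Fin n) (Fin n) F)) i j =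
      if (j : ℕ) = 0 then 0 else x i ⟨j - 1, by omega⟩ := by
  rw [Matrix.mul_apply]
  split_ifs with h
  · refine Finset.sum_eq_zero fun b _ => ?_
    simp [nu, h]
  · rw [Finset.sum_eq_single (⟨j - 1, by omega⟩ : Fin n)]
    · have : (j : ℕ) = j - 1 + 1 := by omega
      simp [nu, ← this]
    · intro b _ hb
      have : ¬(j : ℕ) = b + 1 := fun h' => hb (Fin.ext (by simp only; omega))
      simp [nu, this]
    · simp

theorem exists_nu_mul_eq {u : Matrix (Fin n) (Fin n) F} (hu : u ∈ U n F) :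
    ∃ v ∈ U n F, ((nu : Q n F) : Matrix (Fin n) (Fin n) F) * u = v * (nu : Q n F) := by
  -- v is the lower right (n-1) × (n-1) block of u moved one step up and left, completed by 1 in the
  -- last corner.
  refine ⟨Matrix.of fun i j => if h : (i : ℕ) + 1 < n ∧ (j : ℕ) + 1 < n then
    u ⟨i + 1, h.1⟩ ⟨j + 1, h.2⟩ else if i = j then 1 else 0, ⟨fun i => ?_, fun i j hij => ?_⟩, ?_⟩
  · rw [Matrix.of_apply]
    split_ifs
    · exact hu.1 _
    · rfl
    · exact absurd rfl ‹¬i = i›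
  · rw [Matrix.of_apply]
    split_ifs with h1 h2
    · exact hu.2 _ _ (Fin.mk_lt_mk.2 (Nat.add_lt_add_right hij 1))
    · exact absurd h2 hij.ne'
    · rfl
  · ext i j
    rw [nu_mul_apply, mul_nu_apply, Matrix.of_apply]
    have hj := j.2
    by_cases h2 : (j : ℕ) = 0
    · rw [if_pos h2]
      split_ifs with h1
      · exact hu.2 _ _ (Fin.lt_def.2 (by simp only; omega))
      · rfl
    · rw [if_neg h2]
      have hj1 : (j : ℕ) - 1 + 1 = j := by omega
      by_cases h1 : (i : ℕ) + 1 < n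
      · rw [dif_pos h1, dif_pos ⟨h1, by simp only; omega⟩]
        congr 1
        exact Fin.ext hj1.symm
      · rw [dif_neg h1, dif_neg (fun h => h1 h.1), if_neg]
        rw [Fin.ext_iff]
        simp only
        omega

theorem exists_mul_nu_eq {u : Matrix (Fin n) (Fin n) F} (hu : u ∈ U n F) :
    ∃ v ∈ U n F, u * ((nu : Q n F) : Matrix (Fin n) (Fin n) F) = (nu : Q n F) * v := by
  obtain ⟨v, hv, h⟩ := exists_nu_mul_eq (flipMat_mem_U hu)
  have hnu : flipMat ((nu : Q n F) : Matrix (Fin n) (Fin n) F) = (nu : Q n F) :=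
    congrArg Subtype.val (flip_nu (n := n) (F := F))
  refine ⟨flipMat v, flipMat_mem_U hv, ?_⟩
  have h1 := congrArg flipMat h
  rwa [flipMat_mul, flipMat_mul, flipMat_flipMat, hnu] at h1

theorem mul_diag_twist (t : Fin n → Fˣ) (σ : Q n F) : diag t * σ = σ * diag (twist t σ) := by
  refine ext_entry fun i j => ?_
  rw [entry_diag_mul, entry_mul_diag, mul_comm]
  by_cases h : entry σ i j = 0
  · rw [h, zero_mul, zero_mul]
  · rw [twist, (Equiv.symm_apply_eq _).2 (hat_of_entry_ne_zero σ h).symm]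

theorem twist_rowTorus (σ : Q n F) : twist (rowTorus σ) σ = colTorus σ := by
  funext j
  by_cases hj : j ∈ cols σ
  · have h1 := (mem_cols_iff_hat σ j).1 hj
    have hi : ∃ j', entry σ ((hat σ).symm j) j' ≠ 0 := ⟨j, h1⟩
    have hj' : ∃ i, entry σ i j ≠ 0 := hj
    rw [twist, rowTorus, dif_pos hi, colTorus, dif_pos hj', Units.mk0_inj]
    rw [σ.2.1 _ _ _ hi.choose_spec h1, σ.2.2 _ _ _ hj'.choose_spec h1]
  · have hi : ¬∃ j', entry σ ((hat σ).symm j) j' ≠ 0 := by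
      rintro ⟨j', h⟩
      have h1 := hat_of_entry_ne_zero σ h
      rw [Equiv.apply_symm_apply] at h1
      subst h1
      exact hj ⟨_, h⟩
    have hj' : ¬∃ i, entry σ i j ≠ 0 := hj
    rw [twist, rowTorus, dif_neg hi, colTorus, dif_neg hj']

theorem flip_diag (t : Fin n → Fˣ) : flip (diag t : Q n F) = diag fun i => t i.rev := by
  refine ext_entry fun i j => ?_
  rw [entry_flip]
  change Matrix.diagonal _ _ _ = Matrix.diagonal _ _ _
  rw [Matrix.diagonal_apply, Matrix.diagonal_apply]
  simp only [Fin.rev_inj, eq_comm (a := j)]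
  split_ifs with h
  · rw [h]
  · rfl

theorem hs_eq_diag (k : Fin (n - 1)) (r : Fˣ) : (hs k r : Q n F) =
    diag fun i => if i = lo k then r else if i = hi k then -r⁻¹ else 1 := by
  rw [hs, h, mul_assoc]
  refine ext_entry fun i j => ?_
  rw [simple, entry_perm_mul, entry_diag_mul, entry_perm, Equiv.swap_apply_self]
  change _ = Matrix.diagonal _ _ _
  rw [Matrix.diagonal_apply]
  by_cases h : i = j
  · subst h
    rw [if_pos rfl, if_pos rfl, mul_one]
    congr 1
    by_cases h1 : i = lo k
    · simp [h1, (lo_ne_hi k).symm]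
    · by_cases h2 : i = hi k
      · simp [h2, (lo_ne_hi k).symm]
      · simp [Equiv.swap_apply_of_ne_of_ne h1 h2, h1, h2]
  · rw [if_neg h, if_neg h, mul_zero]

theorem flip_h (k : Fin (n - 1)) (r : Fˣ) : flip (h k.rev r : Q n F) = hs k r := by
  rw [h, flip_diag, hs_eq_diag]
  congr 1
  funext i
  have hi' := i.2
  have hk := k.2
  have h1 : i.rev = lo k.rev ↔ i = hi k := by
    simp only [lo, hi, Fin.ext_iff, Fin.val_rev]; omega
  have h2 : i.rev = hi k.rev ↔ i = lo k := by
    simp only [lo, hi, Fin.ext_iff, Fin.val_rev]; omega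
  simp only [h1, h2]
  by_cases h3 : i = lo k
  · simp [h3, lo_ne_hi k]
  · simp [h3]

theorem exists_mul_diag_eq (t : Fin n → Fˣ) {u : Matrix (Fin n) (Fin n) F} (hu : u ∈ U n F) :
    ∃ v ∈ U n F, u * ((diag t : Q n F) : Matrix (Fin n) (Fin n) F) = (diag t : Q n F) * v := by
  obtain ⟨v, hv, h⟩ := exists_diag_mul_eq t⁻¹ hu
  have h1 : ((diag t : Q n F) : Matrix (Fin n) (Fin n) F) * (diag t⁻¹ : Q n F) = 1 :=
    congrArg Subtype.val ((diag_mul_diag t t⁻¹).trans (by rw [mul_inv_cancel, diag_one]))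
  have h2 : ((diag t⁻¹ : Q n F) : Matrix (Fin n) (Fin n) F) * (diag t : Q n F) = 1 :=
    congrArg Subtype.val ((diag_mul_diag t⁻¹ t).trans (by rw [inv_mul_cancel, diag_one]))
  refine ⟨v, hv, ?_⟩
  calc u * ((diag t : Q n F) : Matrix (Fin n) (Fin n) F)
      = (diag t : Q n F) * ((diag t⁻¹ : Q n F) * u) * (diag t : Q n F) := by
        rw [← mul_assoc, h1, one_mul]
    _ = (diag t : Q n F) * v := by rw [h, mul_assoc, mul_assoc, h2, mul_one]

theorem len_simple (k : Fin (n - 1)) : len (simple k : Q n F) = 1 := by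
  have h1 : ∀ i, rowVal (1 : Q n F) i = i := fun i =>
    rowVal_of_entry_ne_zero (by simp [entry_one])
  rw [← mul_one (simple k : Q n F), len_simple_mul_of_lt, len_one]
  rw [h1, h1]
  exact lo_lt_hi k

/-- The antiautomorphism of the monoid algebra induced by `flipMat`. -/
noncomputable def flipA (a : A n F) : A n F :=
  MulOpposite.unop (MonoidAlgebra.lift ℚ (A n F)ᵐᵒᵖ (Matrix (Fin n) (Fin n) F)
    { toFun := fun x => MulOpposite.op (pt (flipMat x))
      map_one' := by rw [flipMat_one, pt_one]; rfl
      map_mul' := fun x y => by rw [flipMat_mul, pt_mul]; rfl } a)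

theorem flipA_pt (x : Matrix (Fin n) (Fin n) F) : flipA (pt x) = pt (flipMat x) := by
  rw [flipA, pt, MonoidAlgebra.lift_of]
  rfl

theorem flipA_mul (a b : A n F) : flipA (a * b) = flipA b * flipA a := by
  rw [flipA, map_mul]
  rfl

theorem flipA_add (a b : A n F) : flipA (a + b) = flipA a + flipA b := by
  rw [flipA, map_add]
  rfl

theorem flipA_smul (c : ℚ) (a : A n F) : flipA (c • a) = c • flipA a := by
  rw [flipA, map_smul]
  rfl

theorem flipA_sum {ι : Type*} (s : Finset ι) (f : ι → A n F) :
    flipA (∑ i ∈ s, f i) = ∑ i ∈ s, flipA (f i) :=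
  map_sum (AddMonoidHom.mk' flipA flipA_add) f s

theorem flip_simple_mul_flip (k : Fin (n - 1)) (σ : Q n F) :
    flip (simple k.rev * flip σ) = σ * simple k := by
  rw [flip_mul, flip_flip, flip_simple, Fin.rev_rev]

theorem len_mul_simple (k : Fin (n - 1)) (σ : Q n F) :
    len (σ * simple k) = len (simple k.rev * flip σ) := by
  rw [← flip_simple_mul_flip, len_flip]

/-! ### Products of averaged elements and of the T_σ -/

variable [Fintype F]

theorem av_mul_of_forall_left {x : Matrix (Fin n) (Fin n) F}
    (hx : ∀ u ∈ U n F, ∃ v ∈ U n F, x * u = v * x) (y : Matrix (Fin n) (Fin n) F) :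
    av x * av y = av (x * y) := by
  have h1 : eps n F * pt x * eps n F = eps n F * pt x := by
    refine mul_eps_of_forall fun u hu => ?_
    obtain ⟨v, hv, h⟩ := hx u hu
    rw [mul_assoc, ← pt_mul, h, pt_mul, ← mul_assoc, eps_mul_pt hv]
  rw [av, h1, av, av, pt_mul]
  simp only [← mul_assoc]
  rw [h1]

theorem av_mul_of_forall_right {x : Matrix (Fin n) (Fin n) F}
    (hx : ∀ u ∈ U n F, ∃ v ∈ U n F, u * x = x * v) (y : Matrix (Fin n) (Fin n) F) :
    av y * av x = av (y * x) := by
  have h1 : eps n F * (pt x * eps n F) = pt x * eps n F := by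
    refine eps_mul_of_forall fun u hu => ?_
    obtain ⟨v, hv, h⟩ := hx u hu
    rw [← mul_assoc, ← pt_mul, h, pt_mul, mul_assoc, pt_mul_eps hv]
  rw [av, av, av, pt_mul]
  simp only [mul_assoc]
  rw [h1, h1]

/-- Write u = y x(c) with y vanishing in position (k, k+1). Then s y s is again in U and is absorbed
by ε, so only the entry c of u survives. -/
theorem eps_mul_pt_simple_mul (k : Fin (n - 1)) {u : Matrix (Fin n) (Fin n) F} (hu : u ∈ U n F) :
    eps n F * pt (((simple k : Q n F) : Matrix (Fin n) (Fin n) F) * u) =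
      eps n F * pt (((simple k : Q n F) : Matrix (Fin n) (Fin n) F) *
        Matrix.transvection (lo k) (hi k) (u (lo k) (hi k))) := by
  set s : Matrix (Fin n) (Fin n) F := ((simple k : Q n F) : Matrix (Fin n) (Fin n) F) with hs
  set c := u (lo k) (hi k)
  have hy : u * Matrix.transvection (lo k) (hi k) (-c) ∈ U n F :=
    mul_mem_U hu (transvection_mem_U (lo_lt_hi k) _)
  have h0 : (u * Matrix.transvection (lo k) (hi k) (-c)) (lo k) (hi k) = 0 := by
    rw [Matrix.mul_transvection_apply_same, hu.1, mul_one, add_neg_cancel]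
  have h1 : s * u = s * (u * Matrix.transvection (lo k) (hi k) (-c)) * s *
      (s * Matrix.transvection (lo k) (hi k) c) := by
    have h2 : s * s = 1 := coe_simple_mul_simple k
    rw [mul_assoc (s * _) s, ← mul_assoc s s, h2, one_mul, mul_assoc s, mul_assoc u,
      Matrix.transvection_mul_transvection_same _ _ (lo_ne_hi k), neg_add_cancel,
      Matrix.transvection_zero, mul_one]
  rw [h1, pt_mul, ← mul_assoc, eps_mul_pt (simple_mul_mul_simple_mem_U k hy h0)]

theorem av_simple (k : Fin (n - 1)) :
    (Fintype.card F : ℚ) • av ((simple k : Q n F) : Matrix (Fin n) (Fin n) F) =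
      ∑ c : F, eps n F * pt (((simple k : Q n F) : Matrix (Fin n) (Fin n) F) *
        Matrix.transvection (lo k) (hi k) c) := by
  set g := ∑ c : F, eps n F * pt (((simple k : Q n F) : Matrix (Fin n) (Fin n) F) *
        Matrix.transvection (lo k) (hi k) c) with hg
  -- Right multiplication by u merely translates the parameter c by the entry of u in position (k,
  -- k+1). Hence g = gε, and ε on the right absorbs each x(c).
  have h1 : g * eps n F = g := by
    refine mul_eps_of_forall fun u hu => ?_
    rw [hg, Finset.sum_mul]
    refine Eq.trans (Finset.sum_congr rfl fun c _ => ?_)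
      (Equiv.sum_comp (Equiv.addRight (u (lo k) (hi k))) _)
    have h2 := transvection_mem_U (lo_lt_hi k) c
    rw [mul_assoc, ← pt_mul, mul_assoc, eps_mul_pt_simple_mul k (mul_mem_U h2 hu),
      Matrix.transvection_mul_apply_same, hu.1, mul_one, Equiv.coe_addRight, add_comm]
  rw [← h1, hg, Finset.sum_mul, Nat.cast_smul_eq_nsmul, Fintype.card, ← Finset.sum_const]
  refine Finset.sum_congr rfl fun c _ => ?_
  rw [pt_mul, mul_assoc, mul_assoc, pt_mul_eps (transvection_mem_U (lo_lt_hi k) c), av, mul_assoc]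

theorem av_simple_mul_av (k : Fin (n - 1)) (x : Matrix (Fin n) (Fin n) F) :
    (Fintype.card F : ℚ) • (av ((simple k : Q n F) : Matrix (Fin n) (Fin n) F) * av x) =
      ∑ c : F, av (((simple k : Q n F) : Matrix (Fin n) (Fin n) F) *
        (Matrix.transvection (lo k) (hi k) c * x)) := by
  have h1 : av ((simple k : Q n F) : Matrix (Fin n) (Fin n) F) * av x =
      av ((simple k : Q n F) : Matrix (Fin n) (Fin n) F) * (pt x * eps n F) := by
    rw [av, av]
    simp only [mul_assoc]
    rw [← mul_assoc (eps n F) (eps n F), eps_mul_eps]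
  rw [h1, ← smul_mul_assoc, av_simple, Finset.sum_mul]
  refine Finset.sum_congr rfl fun c _ => ?_
  rw [av]
  simp only [pt_mul, mul_assoc]

theorem av_simple_mul_of_le {k : Fin (n - 1)} {σ : Q n F}
    (h : rowVal σ (lo k) ≤ rowVal σ (hi k)) :
    av ((simple k : Q n F) : Matrix (Fin n) (Fin n) F) * av (σ : Matrix (Fin n) (Fin n) F) =
      av ((simple k * σ : Q n F) : Matrix (Fin n) (Fin n) F) := by
  have h1 := av_simple_mul_av k (σ : Matrix (Fin n) (Fin n) F)
  rw [Finset.sum_congr rfl (g := fun _ => av ((simple k * σ : Q n F) : Matrix (Fin n) (Fin n) F)),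
    Finset.sum_const, ← Nat.cast_smul_eq_nsmul ℚ, Finset.card_univ] at h1
  · exact smul_right_injective _ card_ne_zero_rat h1
  · intro c _
    obtain ⟨u, hu, h2⟩ := exists_transvection_mul_eq (lo_ne_hi k) h c
    rw [h2, ← mul_assoc, av_mul_right hu]
    rfl

theorem av_simple_mul_of_gt [DecidableEq F] {k : Fin (n - 1)} {σ : Q n F}
    (hlt : rowVal σ (hi k) < rowVal σ (lo k)) : (Fintype.card F : ℚ) •
    (av ((simple k : Q n F) : Matrix (Fin n) (Fin n) F) * av (σ : Matrix (Fin n) (Fin n) F)) =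
      av ((simple k * σ : Q n F) : Matrix (Fin n) (Fin n) F) +
        ∑ r : Fˣ, av ((h k r * σ : Q n F) : Matrix (Fin n) (Fin n) F) := by
  rw [av_simple_mul_av, ← Finset.add_sum_erase _ _ (Finset.mem_univ (0 : F)),
    Matrix.transvection_zero, one_mul]
  congr 1
  refine (Finset.sum_bij (fun (r : Fˣ) _ => (r : F)) ?_ ?_ ?_ ?_).symm
  · intro r _
    simp
  · intro r _ r' _ h
    exact Units.ext h
  · intro c hc
    exact ⟨Units.mk0 c (Finset.ne_of_mem_erase hc), Finset.mem_univ _, rfl⟩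
  · intro r _
    -- The lower transvection has its two rows exchanged, and in this case their values are in the
    -- order that lets it pass σ.
    obtain ⟨u, hu, h2⟩ := exists_transvection_mul_eq (lo_ne_hi k).symm hlt.le ((r⁻¹ : Fˣ) : F)
    rw [← mul_assoc, simple_mul_transvection, mul_assoc,
      av_mul_left (transvection_mem_U (lo_lt_hi k) _), mul_assoc, h2, ← mul_assoc,
      av_mul_right hu]
    rfl

theorem T_diag_mul (t : Fin n → Fˣ) (σ : Q n F) : T (diag t) * T σ = T (diag t * σ) := by
  have h0 : len (diag t : Q n F) = 0 := by
    rw [← mul_one (diag t : Q n F), len_diag_mul, len_one]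
  rw [T_eq_smul_av, T_eq_smul_av, T_eq_smul_av, h0, pow_zero, one_smul, len_diag_mul,
    mul_smul_comm, av_mul_of_forall_left fun u hu => exists_diag_mul_eq t hu]
  rfl

theorem T_mul_diag (t : Fin n → Fˣ) (σ : Q n F) : T σ * T (diag t) = T (σ * diag t) := by
  have h0 : len (diag t : Q n F) = 0 := by
    rw [← mul_one (diag t : Q n F), len_diag_mul, len_one]
  rw [T_eq_smul_av, T_eq_smul_av, T_eq_smul_av, h0, pow_zero, one_smul, len_mul_diag,
    smul_mul_assoc, av_mul_of_forall_right fun u hu => exists_mul_diag_eq t hu]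
  rfl

theorem T_one_mul (σ : Q n F) : T (1 : Q n F) * T σ = T σ := by
  rw [← diag_one, T_diag_mul, diag_one, one_mul]

theorem T_mul_one (σ : Q n F) : T σ * T (1 : Q n F) = T σ := by
  rw [← diag_one, T_mul_diag, diag_one, mul_one]

/-- The exponent is written m + 1 because the zeroth power is the unit of the whole algebra, whereas
T_1 = ε. -/
theorem T_diag_pow (t : Fin n → Fˣ) (m : ℕ) :
    T (diag t : Q n F) ^ (m + 1) = T (diag (t ^ (m + 1)) : Q n F) := by
  induction m with
  | zero => rw [zero_add, pow_one, pow_one]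
  | succ m ih => rw [pow_succ, ih, T_diag_mul, diag_mul_diag, ← pow_succ]

theorem pow_card_sub_one_eq_one (t : Fin n → Fˣ) : t ^ (Fintype.card F - 1) = 1 := by
  classical
  funext i
  rw [Pi.pow_apply, ← Fintype.card_units, pow_card_eq_one, Pi.one_apply]

theorem T_nu_mul (σ : Q n F) : T nu * T σ =
    (Fintype.card F : ℚ) ^ ((len σ : ℤ) - (len (nu * σ) : ℤ)) • T (nu * σ) := by
  have h0 : len (nu : Q n F) = 0 := pow_one (nu : Q n F) ▸ len_nu_pow 1
  rw [T_eq_smul_av, T_eq_smul_av, T_eq_smul_av, h0, pow_zero, one_smul, mul_smul_comm,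
    av_mul_of_forall_left fun u hu => exists_nu_mul_eq hu, smul_smul, ← zpow_natCast,
    ← zpow_natCast, ← zpow_add₀ card_ne_zero_rat, sub_add_cancel]
  rfl

theorem T_mul_nu (σ : Q n F) : T σ * T nu =
    (Fintype.card F : ℚ) ^ ((len σ : ℤ) - (len (σ * nu) : ℤ)) • T (σ * nu) := by
  have h0 : len (nu : Q n F) = 0 := pow_one (nu : Q n F) ▸ len_nu_pow 1
  rw [T_eq_smul_av, T_eq_smul_av, T_eq_smul_av, h0, pow_zero, one_smul, smul_mul_assoc,
    av_mul_of_forall_right fun u hu => exists_mul_nu_eq hu, smul_smul, ← zpow_natCast,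
    ← zpow_natCast, ← zpow_add₀ card_ne_zero_rat, sub_add_cancel]
  rfl

theorem T_simple_mul_of_lt {k : Fin (n - 1)} {σ : Q n F}
    (h : rowVal σ (lo k) < rowVal σ (hi k)) : T (simple k) * T σ = T (simple k * σ) := by
  rw [T_eq_smul_av, T_eq_smul_av, T_eq_smul_av, len_simple, len_simple_mul_of_lt h,
    smul_mul_smul_comm, av_simple_mul_of_le h.le, pow_one, ← pow_succ']

theorem T_simple_mul_of_eq {k : Fin (n - 1)} {σ : Q n F}
    (h : rowVal σ (lo k) = rowVal σ (hi k)) :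
    T (simple k) * T σ = (Fintype.card F : ℚ) • T σ := by
  rw [T_eq_smul_av, T_eq_smul_av, len_simple, smul_mul_smul_comm, av_simple_mul_of_le h.le,
    simple_mul_of_rowVal_eq h, pow_one, smul_smul]

theorem T_simple_mul_of_gt [DecidableEq F] {k : Fin (n - 1)} {σ : Q n F}
    (hlt : rowVal σ (hi k) < rowVal σ (lo k)) : T (simple k) * T σ =
      (Fintype.card F : ℚ) • T (simple k * σ) + ∑ r : Fˣ, T (h k r) * T σ := by
  have h1 : ∀ r : Fˣ, T (h k r) * T σ = (Fintype.card F : ℚ) ^ len σ •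
      av ((h k r * σ : Q n F) : Matrix (Fin n) (Fin n) F) := by
    intro r
    rw [h, T_diag_mul, T_eq_smul_av, len_diag_mul]
  rw [Finset.sum_congr rfl fun r _ => h1 r, ← Finset.smul_sum, T_eq_smul_av, T_eq_smul_av σ,
    T_eq_smul_av (simple k * σ), len_simple, smul_mul_smul_comm, pow_one, mul_comm, mul_smul,
    av_simple_mul_of_gt hlt, smul_smul, ← pow_succ', len_simple_mul_of_gt hlt, smul_add]

theorem flipA_eps : flipA (eps n F) = eps n F := by
  rw [eps, flipA_smul, flipA_sum]
  simp_rw [flipA_pt]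
  rw [sum_comp_of_injOn_of_mapsTo (fun x _ y _ h => ?_)
    fun v hv => mem_uFin.2 (flipMat_mem_U (mem_uFin.1 hv))]
  rw [← flipMat_flipMat x, h, flipMat_flipMat]

theorem flipA_T (σ : Q n F) : flipA (T σ) = T (flip σ) := by
  rw [T_eq_smul_av, T_eq_smul_av, flipA_smul, len_flip, av, flipA_mul, flipA_mul, flipA_eps,
    flipA_pt, av, mul_assoc]
  rfl

theorem T_mul_simple_eq (k : Fin (n - 1)) (σ : Q n F) :
    T σ * T (simple k) = flipA (T (simple k.rev) * T (flip σ)) := by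
  rw [flipA_mul, flipA_T, flipA_T, flip_flip, flip_simple, Fin.rev_rev]

end Products

/-! ### Disjointness of double cosets and linear independence -/

section Independence

variable {n : ℕ} {F : Type*} [Field F]

/-- An entry of σ forces an entry of τ in the same row, weakly to the left; an entry of τ forces one
of σ in the same column, weakly below. Chaining the two and inducting upwards from the last row pins
the entries together, and the diagonal ones in u and v make their values agree. -/
theorem eq_of_mul_eq_mul {σ τ : Q n F} {u v : Matrix (Fin n) (Fin n) F} (hu : u ∈ U n F)
    (hv : v ∈ U n F) (h : u * (σ : Matrix (Fin n) (Fin n) F) = τ * v) : σ = τ := by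
  have h1 : ∀ {i j}, entry σ i j ≠ 0 → ∃ j' ≤ j, entry τ i j' ≠ 0 ∧
      entry σ i j = entry τ i j' * v j' j := by
    intro i j hij
    have h2 := congrFun (congrFun h i) j
    rw [mul_coe_apply u σ hij, hu.1, one_mul] at h2
    by_cases hi : i ∈ rows τ
    · obtain ⟨j', hj'⟩ := hi
      rw [coe_mul_apply v τ hj'] at h2
      refine ⟨j', not_lt.1 fun hlt => hij ?_, hj', h2⟩
      rw [h2, hv.2 _ _ hlt, mul_zero]
    · rw [coe_mul_apply_of_notMem v τ hi] at h2
      exact absurd h2 hij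
  have h1' : ∀ {i j}, entry τ i j ≠ 0 → ∃ i' ≥ i, entry σ i' j ≠ 0 := by
    intro i j hij
    have h2 := congrFun (congrFun h i) j
    rw [coe_mul_apply v τ hij, hv.1, mul_one] at h2
    by_cases hj : j ∈ cols σ
    · obtain ⟨i', hi'⟩ := hj
      rw [mul_coe_apply u σ hi'] at h2
      refine ⟨i', not_lt.1 fun hlt => hij ?_, hi'⟩
      rw [← h2, hu.2 _ _ hlt, zero_mul]
    · rw [mul_coe_apply_of_notMem u σ hj] at h2
      exact absurd h2.symm hij
  have h3 : ∀ i j, entry σ i j ≠ 0 → entry σ i j = entry τ i j := by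
    intro i
    induction i using WellFoundedGT.induction with
    | ind i ih =>
      intro j hij
      obtain ⟨j', -, hj', he⟩ := h1 hij
      obtain ⟨i', hi', hij'⟩ := h1' hj'
      rcases (show i ≤ i' from hi').eq_or_lt with rfl | hlt
      · obtain rfl := σ.2.1 _ _ _ hij hij'
        rw [he, hv.1, mul_one]
      -- If the chain ended strictly lower, the induction hypothesis would put a second nonzero
      -- entry of τ in column j'.
      · have h4 := ih i' hlt j' hij'
        exact absurd (τ.2.2 _ _ _ hj' (ne_of_eq_of_ne h4.symm hij')) hlt.ne
  refine ext_entry fun i j => ?_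
  by_cases hij : entry σ i j = 0
  · rw [hij]
    by_contra hτ
    obtain ⟨i', -, hi'⟩ := h1' (Ne.symm hτ)
    have h4 := h3 i' j hi'
    obtain rfl := τ.2.2 _ _ _ (Ne.symm hτ) (ne_of_eq_of_ne h4.symm hi')
    exact hi' hij
  · exact h3 i j hij

variable [Fintype F]

theorem coe_mem_cosetFin_iff {σ τ : Q n F} :
    (τ : Matrix (Fin n) (Fin n) F) ∈ cosetFin σ ↔ τ = σ := by
  refine ⟨fun h => ?_, fun h => h ▸ self_mem_cosetFin σ⟩
  obtain ⟨u, hu, v, hv, h⟩ := mem_cosetFin.1 h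
  refine (eq_of_mul_eq_mul hu (inv_mem_U hv) ?_).symm
  rw [h, mul_assoc, mul_inv_of_mem_U hv, mul_one]

theorem linearIndependent_T : LinearIndependent ℤ (T : Q n F → A n F) := by
  classical
  have h1 : LinearIndependent ℚ (T : Q n F → A n F) := by
    rw [linearIndependent_iff']
    intro s g hg τ hτ
    -- Among the double coset sums only that of τ contains the matrix τ, so this coefficient
    -- isolates one summand.
    have h2 := congrArg (fun a => a.coeff (τ : Matrix (Fin n) (Fin n) F)) hg
    simp only [MonoidAlgebra.coeff_sum, Finsupp.finsetSum_apply, T, MonoidAlgebra.coeff_smul_apply,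
      coeff_cosetSum, coe_mem_cosetFin_iff, MonoidAlgebra.coeff_zero, Finsupp.zero_apply,
      smul_eq_mul, mul_ite, mul_one, mul_zero] at h2
    rw [Finset.sum_ite_eq, if_pos hτ] at h2
    exact (mul_eq_zero.1 h2).resolve_right (zpow_ne_zero _ card_ne_zero_rat)
  exact h1.restrict_scalars' ℤ

end Independence

/-! ### Ring structure, generators and multiplication rules -/

section Ring

variable {n : ℕ} {F : Type*} [Field F] [Fintype F]

/-- The generators `T_{s_k}`, `T_t` and `T_ν`. -/
def generators (n : ℕ) (F : Type*) [Field F] [Fintype F] : Set (A n F) :=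
  Set.range (fun k : Fin (n - 1) => T (simple k : Q n F)) ∪
    Set.range (fun t : Fin n → Fˣ => T (diag t)) ∪ {T (nu : Q n F)}

theorem T_mem_H (σ : Q n F) : T σ ∈ H n F := Submodule.subset_span ⟨σ, rfl⟩

theorem card_smul_T_mem_H (σ : Q n F) : (Fintype.card F : ℚ) • T σ ∈ H n F := by
  rw [Nat.cast_smul_eq_nsmul]
  exact nsmul_mem (T_mem_H σ) _

theorem generators_mul_T_mem_H {a : A n F} (ha : a ∈ generators n F) (σ : Q n F) :
    a * T σ ∈ H n F := by
  classical
  rcases ha with (⟨k, rfl⟩ | ⟨t, rfl⟩) | rfl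
  · simp only
    rcases lt_trichotomy (rowVal σ (lo k)) (rowVal σ (hi k)) with h1 | h1 | h1
    · rw [T_simple_mul_of_lt h1]
      exact T_mem_H _
    · rw [T_simple_mul_of_eq h1]
      exact card_smul_T_mem_H _
    · rw [T_simple_mul_of_gt h1]
      refine add_mem (card_smul_T_mem_H _) (sum_mem fun r _ => ?_)
      rw [h, T_diag_mul]
      exact T_mem_H _
  · simp only
    rw [T_diag_mul]
    exact T_mem_H _
  -- Since `len` does not increase under ν, the power of q is a nonnegative integer and the product
  -- stays in the integral span.
  · rw [T_nu_mul, ← Nat.cast_sub (len_nu_mul_le σ), zpow_natCast, ← Nat.cast_pow,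
      Nat.cast_smul_eq_nsmul]
    exact nsmul_mem (T_mem_H _) _

theorem mul_mem_H_of_forall {a : A n F} (ha : ∀ σ, a * T σ ∈ H n F) {x : A n F}
    (hx : x ∈ H n F) : a * x ∈ H n F := by
  induction hx using Submodule.span_induction with
  | mem x hx => obtain ⟨σ, rfl⟩ := hx; exact ha σ
  | zero => rw [mul_zero]; exact zero_mem _
  | add x y _ _ hx hy => rw [mul_add]; exact add_mem hx hy
  | smul m x _ hx => rw [mul_smul_comm]; exact Submodule.smul_mem _ _ hx

theorem closure_mul_mem_H {a x : A n F} (ha : a ∈ NonUnitalSubring.closure (generators n F))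
    (hx : x ∈ H n F) : a * x ∈ H n F := by
  induction ha using NonUnitalSubring.closure_induction generalizing x with
  | mem a ha => exact mul_mem_H_of_forall (generators_mul_T_mem_H ha) hx
  | zero => rw [zero_mul]; exact zero_mem _
  | add a b _ _ iha ihb => rw [add_mul]; exact add_mem (iha hx) (ihb hx)
  | neg a _ iha => rw [neg_mul]; exact neg_mem (iha hx)
  | mul a b _ _ iha ihb => rw [mul_assoc]; exact iha (ihb hx)

theorem T_simple_mem_closure (k : Fin (n - 1)) :
    T (simple k : Q n F) ∈ NonUnitalSubring.closure (generators n F) :=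
  NonUnitalSubring.subset_closure (Or.inl (Or.inl ⟨k, rfl⟩))

theorem T_diag_mem_closure (t : Fin n → Fˣ) :
    T (diag t : Q n F) ∈ NonUnitalSubring.closure (generators n F) :=
  NonUnitalSubring.subset_closure (Or.inl (Or.inr ⟨t, rfl⟩))

theorem T_nu_pow_mem_closure (m : ℕ) :
    T (nu ^ m : Q n F) ∈ NonUnitalSubring.closure (generators n F) := by
  induction m with
  | zero => rw [pow_zero, ← diag_one]; exact T_diag_mem_closure 1
  | succ m ih =>
    have h1 := T_nu_mul (nu ^ m : Q n F)
    rw [← pow_succ', len_nu_pow, len_nu_pow, sub_self, zpow_zero, one_smul] at h1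
    rw [← h1]
    exact mul_mem (NonUnitalSubring.subset_closure (Or.inr rfl)) ih

theorem T_mul_simple_of_len {k : Fin (n - 1)} {σ : Q n F} (h : len (σ * simple k) = len σ + 1) :
    T σ * T (simple k) = T (σ * simple k) := by
  rw [len_mul_simple, ← len_flip σ] at h
  rcases lt_trichotomy (rowVal (flip σ) (lo k.rev)) (rowVal (flip σ) (hi k.rev)) with h1 | h1 | h1
  · rw [T_mul_simple_eq, T_simple_mul_of_lt h1, flipA_T, flip_simple_mul_flip]
  · rw [simple_mul_of_rowVal_eq h1] at h; omega
  · have := len_simple_mul_of_gt h1; omega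

theorem T_simple_mul_of_len {k : Fin (n - 1)} {σ : Q n F} (h : len (simple k * σ) = len σ + 1) :
    T (simple k) * T σ = T (simple k * σ) := by
  rcases lt_trichotomy (rowVal σ (lo k)) (rowVal σ (hi k)) with h1 | h1 | h1
  · exact T_simple_mul_of_lt h1
  · rw [simple_mul_of_rowVal_eq h1] at h; omega
  · have := len_simple_mul_of_gt h1; omega

/-- Descent on length: removing a descent on either side factors T_σ without correction terms, and
an element of length zero is a torus element times a power of ν. -/
theorem T_mem_closure (σ : Q n F) : T σ ∈ NonUnitalSubring.closure (generators n F) := by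
  induction hm : len σ generalizing σ with
  | zero =>
    rw [← rowTorus_mul_supp σ, ← T_diag_mul, supp_eq_of_len_eq_zero hm]
    exact mul_mem (T_diag_mem_closure _) (T_nu_pow_mem_closure _)
  | succ m ih =>
    rcases exists_descent (σ := σ) (by omega) with ⟨k, hk⟩ | ⟨k, hk⟩
    · have h1 := T_simple_mul_of_len (k := k) (σ := simple k * σ)
        (by rw [simple_mul_cancel_left, hk])
      rw [simple_mul_cancel_left] at h1
      rw [← h1]
      exact mul_mem (T_simple_mem_closure k) (ih _ (by omega))
    · have h1 := T_mul_simple_of_len (k := k) (σ := σ * simple k)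
        (by rw [simple_mul_cancel_right, hk])
      rw [simple_mul_cancel_right] at h1
      rw [← h1]
      exact mul_mem (ih _ (by omega)) (T_simple_mem_closure k)

theorem H_subset_closure {x : A n F} (hx : x ∈ H n F) :
    x ∈ NonUnitalSubring.closure (generators n F) := by
  induction hx using Submodule.span_induction with
  | mem x hx => obtain ⟨σ, rfl⟩ := hx; exact T_mem_closure σ
  | zero => exact zero_mem _
  | add x y _ _ hx hy => exact add_mem hx hy
  | smul m x _ hx => exact zsmul_mem hx m

/-- The left factor is a polynomial in the generators, so stability of H under left multiplication
by generators suffices. -/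
theorem mul_mem_H {x y : A n F} (hx : x ∈ H n F) (hy : y ∈ H n F) : x * y ∈ H n F :=
  closure_mul_mem_H (H_subset_closure hx) hy

theorem T_one_mul_of_mem_H {x : A n F} (hx : x ∈ H n F) : T (1 : Q n F) * x = x := by
  induction hx using Submodule.span_induction with
  | mem x hx => obtain ⟨σ, rfl⟩ := hx; exact T_one_mul σ
  | zero => rw [mul_zero]
  | add x y _ _ hx hy => rw [mul_add, hx, hy]
  | smul m x _ hx => rw [mul_smul_comm, hx]

theorem mul_T_one_of_mem_H {x : A n F} (hx : x ∈ H n F) : x * T (1 : Q n F) = x := by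
  induction hx using Submodule.span_induction with
  | mem x hx => obtain ⟨σ, rfl⟩ := hx; exact T_mul_one σ
  | zero => rw [zero_mul]
  | add x y _ _ hx hy => rw [add_mul, hx, hy]
  | smul m x _ hx => rw [smul_mul_assoc, hx]

theorem closure_generators_eq_H :
    (NonUnitalSubring.closure (generators n F) : Set (A n F)) = (H n F : Set (A n F)) := by
  refine Set.Subset.antisymm (fun a ha => ?_) fun x hx => H_subset_closure hx
  refine NonUnitalSubring.closure_induction (p := fun a _ => a ∈ H n F) ?_ (zero_mem _)
    (fun _ _ _ _ => add_mem) (fun _ _ => neg_mem) (fun _ _ _ _ => mul_mem_H) ha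
  rintro _ ((⟨k, rfl⟩ | ⟨t, rfl⟩) | rfl) <;> exact T_mem_H _

theorem T_simple_mul [DecidableEq F] (k : Fin (n - 1)) (σ : Q n F) :
    (len (simple k * σ) = len σ ∨ len (simple k * σ) = len σ + 1 ∨
      len (simple k * σ) + 1 = len σ) ∧
    (len (simple k * σ) = len σ → T (simple k) * T σ = (Fintype.card F : ℚ) • T σ) ∧
    (len (simple k * σ) = len σ + 1 → T (simple k) * T σ = T (simple k * σ)) ∧
    (len (simple k * σ) + 1 = len σ → T (simple k) * T σ =
      (Fintype.card F : ℚ) • T (simple k * σ) + ∑ r : Fˣ, T (h k r) * T σ) := by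
  rcases lt_trichotomy (rowVal σ (lo k)) (rowVal σ (hi k)) with h1 | h1 | h1
  · have h2 := len_simple_mul_of_lt h1
    exact ⟨Or.inr (Or.inl h2), fun _ => by omega, fun _ => T_simple_mul_of_lt h1,
      fun _ => by omega⟩
  · have h2 := congrArg len (simple_mul_of_rowVal_eq h1)
    exact ⟨Or.inl h2, fun _ => T_simple_mul_of_eq h1, fun _ => by omega, fun _ => by omega⟩
  · have h2 := len_simple_mul_of_gt h1
    exact ⟨Or.inr (Or.inr h2), fun _ => by omega, fun _ => by omega,
      fun _ => T_simple_mul_of_gt h1⟩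

/-- The antiautomorphism of the algebra preserves `len` and reverses [n-1]; it exchanges the two
diagonal positions of h, which is why h^s appears on the right. -/
theorem T_mul_simple [DecidableEq F] (k : Fin (n - 1)) (σ : Q n F) :
    (len (σ * simple k) = len σ ∨ len (σ * simple k) = len σ + 1 ∨
      len (σ * simple k) + 1 = len σ) ∧
    (len (σ * simple k) = len σ → T σ * T (simple k) = (Fintype.card F : ℚ) • T σ) ∧
    (len (σ * simple k) = len σ + 1 → T σ * T (simple k) = T (σ * simple k)) ∧
    (len (σ * simple k) + 1 = len σ → T σ * T (simple k) =
      (Fintype.card F : ℚ) • T (σ * simple k) + ∑ r : Fˣ, T σ * T (hs k r)) := by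
  obtain ⟨h1, h2, h3, h4⟩ := T_simple_mul k.rev (flip σ)
  rw [← len_mul_simple, len_flip] at h1 h2 h3 h4
  refine ⟨h1, fun h => ?_, fun h => ?_, fun h => ?_⟩
  · rw [T_mul_simple_eq, h2 h, flipA_smul, flipA_T, flip_flip]
  · rw [T_mul_simple_eq, h3 h, flipA_T, flip_simple_mul_flip]
  · rw [T_mul_simple_eq, h4 h, flipA_add, flipA_smul, flipA_T, flip_simple_mul_flip, flipA_sum]
    simp_rw [flipA_mul, flipA_T, flip_flip, flip_h]

end Ring

end FramedRook

theorem mainTheorem5 {F : Type*} [Field F] [Fintype F] [DecidableEq F]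
    (hq : Odd (Fintype.card F)) (n : ℕ) (hn : 0 < n) :
    -- `H(M, U)` is the direct sum of the `ℤ T_σ`
    LinearIndependent ℤ (T : Q n F → A n F) ∧
    -- it is a ring with unit `T_1`
    (∀ x ∈ H n F, ∀ y ∈ H n F, x * y ∈ H n F) ∧
    (T (1 : Q n F) ∈ H n F ∧ ∀ x ∈ H n F, T (1 : Q n F) * x = x ∧ x * T (1 : Q n F) = x) ∧
    -- generated by the `T_{s_k}`, the `T_t` (these include the unit `T_1`) and `T_ν`
    ((NonUnitalSubring.closure
        (Set.range (fun k : Fin (n - 1) => T (simple k : Q n F)) ∪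
          Set.range (fun t : Fin n → Fˣ => T (diag t)) ∪ {T (nu : Q n F)}) : Set (A n F)) =
      (H n F : Set (A n F))) ∧
    -- the torus
    (∀ t : Fin n → Fˣ, T (diag t) ^ (Fintype.card F - 1) = T (1 : Q n F)) ∧
    (∀ t t' : Fin n → Fˣ, T (diag t) * T (diag t') = T (diag t') * T (diag t)) ∧
    (∀ (t : Fin n → Fˣ) (σ : Q n F),
      T (diag t) * T σ = T (diag t * σ) ∧
      T (diag t * σ) = T (σ * diag (twist t σ)) ∧
      T (σ * diag (twist t σ)) = T σ * T (diag (twist t σ))) ∧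
    (∀ σ : Q n F, twist (rowTorus σ) σ = colTorus σ ∧
      T (diag (rowTorus σ)) * T σ = T (diag (rowTorus σ) * σ) ∧
      T (diag (rowTorus σ) * σ) = T (σ * diag (colTorus σ)) ∧
      T (σ * diag (colTorus σ)) = T σ * T (diag (colTorus σ))) ∧
    -- left multiplication by `T_{s_k}`
    (∀ (k : Fin (n - 1)) (σ : Q n F),
      (length (simple k * σ) = length σ ∨ length (simple k * σ) = length σ + 1 ∨
        length (simple k * σ) + 1 = length σ) ∧
      (length (simple k * σ) = length σ →
        T (simple k) * T σ = (Fintype.card F : ℚ) • T σ) ∧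
      (length (simple k * σ) = length σ + 1 →
        T (simple k) * T σ = T (simple k * σ)) ∧
      (length (simple k * σ) + 1 = length σ →
        T (simple k) * T σ =
          (Fintype.card F : ℚ) • T (simple k * σ) + ∑ r : Fˣ, T (h k r) * T σ)) ∧
    -- right multiplication by `T_{s_k}`
    (∀ (k : Fin (n - 1)) (σ : Q n F),
      (length (σ * simple k) = length σ ∨ length (σ * simple k) = length σ + 1 ∨
        length (σ * simple k) + 1 = length σ) ∧
      (length (σ * simple k) = length σ →
        T σ * T (simple k) = (Fintype.card F : ℚ) • T σ) ∧
      (length (σ * simple k) = length σ + 1 →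
        T σ * T (simple k) = T (σ * simple k)) ∧
      (length (σ * simple k) + 1 = length σ →
        T σ * T (simple k) =
          (Fintype.card F : ℚ) • T (σ * simple k) + ∑ r : Fˣ, T σ * T (hs k r))) ∧
    -- multiplication by `T_ν`
    (∀ σ : Q n F,
      T nu * T σ =
        (Fintype.card F : ℚ) ^ ((length σ : ℤ) - (length (nu * σ) : ℤ)) • T (nu * σ) ∧
      T σ * T nu =
        (Fintype.card F : ℚ) ^ ((length σ : ℤ) - (length (σ * nu) : ℤ)) • T (σ * nu)) := by
  simp only [length_eq_len]
  refine ⟨linearIndependent_T, fun x hx y hy => mul_mem_H hx hy,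
    ⟨T_mem_H 1, fun x hx => ⟨T_one_mul_of_mem_H hx, mul_T_one_of_mem_H hx⟩⟩,
    closure_generators_eq_H, fun t => ?_, fun t t' => ?_, fun t σ => ⟨T_diag_mul t σ, ?_, ?_⟩,
    fun σ => ⟨twist_rowTorus σ, T_diag_mul _ σ, ?_, (T_mul_diag _ σ).symm⟩,
    T_simple_mul, T_mul_simple, fun σ => ⟨T_nu_mul σ, T_mul_nu σ⟩⟩
  · obtain ⟨m, hm⟩ : ∃ m, Fintype.card F - 1 = m + 1 :=
      ⟨Fintype.card F - 2, by have := Fintype.one_lt_card (α := F); omega⟩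
    rw [hm, T_diag_pow, ← hm, pow_card_sub_one_eq_one, diag_one]
  · rw [T_diag_mul, T_diag_mul, diag_mul_diag, diag_mul_diag, mul_comm]
  · rw [mul_diag_twist]
  · rw [T_mul_diag]
  · rw [mul_diag_twist, twist_rowTorus]
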